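/- Let $\Omega\subset\mathbb R^3$ be a bounded polyhedral domain with Lipschitz boundary and $\mathcal T_h$ a conforming triangulation of $\overline\Omega$ by tetrahedra that is shape regular: every $K\in\mathcal T_h$ contains a ball of diameter at least $h_K/\kappa$, where $h_K=\operatorname{diam}K$. Let $\mu>0$ be constant, equal to $\mu_K$, on each $K\in\mathcal T_h$. Fix a unit normal $\boldsymbol n_F$ for each face $F$ and a unit tangent $\boldsymbol t_e$ for each edge $e$; for an interior face $F$ let $K_-$, $K_+$ be the two elements sharing $F$, with $\boldsymbol n_F$ pointing from $K_-$ to $K_+$, and let $[\![v]\!]_F=v|_{K_-}-v|_{K_+}$ and $\mu_F^{-1}=\tfrac12(\mu_{K_-}^{-1}+\mu_{K_+}^{-1})$. For an edge $e$, let $\omega_e$ be the set of elements having $e$ as an edge, $\widetilde\omega_e$ (resp. $\widehat\omega_e$) the set of elements of $\omega_e$ on which $\mu^{-1}$ is largest (resp. smallest) in $\omega_e$, $\omega_{e,F}$ the set of interior faces of $\omega_e$ (faces shared by two elements of $\omega_e$), and $\widehat\omega_{e,F}$ the set of faces in $\omega_{e,F}$ that are faces of an element of $\widehat\omega_e$.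 Write $|\widehat\omega_{e,F}|$ for the total area of the faces in $\widehat\omega_{e,F}$. Assume that $\mu^{-1}$ is quasi-monotone in the edge patches. Call $K,K'\in\omega_e$ monotonically connected if there are $K=K_0,K_1,\dots,K_l=K'$ in $\omega_e$ such that $K_{i-1}$ and $K_i$ share a face and $\mu_{K_{i-1}}^{-1}\le\mu_{K_i}^{-1}$ for $i=1,\dots,l$. For every interior edge $e$, every $K\in\omega_e$ is monotonically connected to every $K'\in\widetilde\omega_e$. For every boundary edge $e$, every $K\in\omega_e\setminus\widetilde\omega_e$ is monotonically connected to every $K'\in\widetilde\omega_e$, and at least one of the boundary faces containing $e$ is a face of an element of $\widetilde\omega_e$. Let $\boldsymbol u_h$ belong to the lowest order Nédélec space, that is, $\boldsymbol u_h\in \boldsymbol H(\mathbf{curl};\Omega)$ and $\boldsymbol u_h|_K(\boldsymbol x)=\boldsymbol a_K+\boldsymbol b_K\times\boldsymbol x$ on each $K$ (for instance the finite element solution). Put $\boldsymbol\sigma_{h,K}=\mu_K^{-1}\nabla\times\boldsymbol u_h|_K$ and, on an interior face $F$, $$\boldsymbol\sigma_{h,F}=\gamma_F^-\boldsymbol\sigma_{h,K_-}+(1-\gamma_F^-)\boldsymbol\sigma_{h,K_+},\qquad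 \gamma_F^-=\frac{\mu_{K_+}^{-1/2}}{\mu_{K_-}^{-1/2}+\mu_{K_+}^{-1/2}} .$$ Let $K\in\mathcal T_h$ be an element each of whose edges lies on at least one interior face. With $\mathcal E_h(K)$ the set of edges of $K$ and $\boldsymbol\varphi_e$ the Nédélec nodal basis functions (on $K$, $\boldsymbol\varphi_e\cdot\boldsymbol t_{e'}=\delta_{ee'}$ on the edges $e'$ of $K$), the recovered field is, on $K$, $$\boldsymbol\sigma_h^*=\sum_{e\in\mathcal E_h(K)}\Bigl(\sum_{F\in\widehat\omega_{e,F}}\frac1{|\widehat\omega_{e,F}|}\int_F\boldsymbol\sigma_{h,F}\cdot\boldsymbol t_e\,dS\Bigr)\boldsymbol\varphi_e ,$$ and $\eta_{K,\perp}=\|\mu^{1/2}\boldsymbol\sigma_h^*-\mu^{-1/2}\nabla\times\boldsymbol u_h\|_{\boldsymbol L^2(K)}$. Then there is a constant $c>0$ depending only on the shape-regularity parameter $\kappa$, and in particular independent of $\mu$ and its jumps, such that for all such $K$, with $h_F=\operatorname{diam}F$, $$c\,\eta_{K,\perp}\le\sum_{e\in\mathcal E_h(K)}\ \sum_{F\in\omega_{e,F}}h_F^{1/2}\,\bigl\|\mu_F^{1/2}[\![(\mu^{-1}\nabla\times\boldsymbol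 u_h)\times\boldsymbol n]\!]_F\bigr\|_{\boldsymbol L^2(F)} .$$ -/

import Mathlib

open MeasureTheory Set
open scoped RealInnerProductSpace Matrix ContDiff NNReal

noncomputable section

namespace EdgeRecovery

/-- Euclidean three-space. -/
abbrev E3 := EuclideanSpace ℝ (Fin 3)

/-! ### Vector calculus -/

/-- The cross product of two vectors. -/
def cross (a b : E3) : E3 := WithLp.toLp 2 (a.ofLp ⨯₃ b.ofLp)

/-- The partial derivative `∂ᵢ vⱼ` at `x`. -/
def partialDeriv (v : E3 → E3) (i j : Fin 3) (x : E3) : ℝ :=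
  (fderiv ℝ v x (EuclideanSpace.single i 1)) j

/-- The classical curl of a vector field. -/
def curl (v : E3 → E3) (x : E3) : E3 :=
  !₂[partialDeriv v 1 2 x - partialDeriv v 2 1 x,
     partialDeriv v 2 0 x - partialDeriv v 0 2 x,
     partialDeriv v 0 1 x - partialDeriv v 1 0 x]

/-- `v ∈ H(curl; Ω)`: both `v` and its weak curl `w` are square integrable on `Ω`. -/
def InHCurl (Ω : Set E3) (v : E3 → E3) : Prop :=
  MemLp v 2 (volume.restrict Ω) ∧
    ∃ w : E3 → E3, MemLp w 2 (volume.restrict Ω) ∧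
      ∀ φ : E3 → E3, ContDiff ℝ ∞ φ → HasCompactSupport φ → tsupport φ ⊆ Ω →
        ∫ x in Ω, ⟪v x, curl φ x⟫ = ∫ x in Ω, ⟪w x, φ x⟫

/-! ### Domains and triangulations -/

/-- A bounded domain (nonempty, open, connected) with Lipschitz boundary: around each boundary
point, and with respect to some direction `ν`, the domain is the part of space strictly below the
graph of a Lipschitz function. A function of the two coordinates orthogonal to `ν` is the same as a
function on space that is invariant under translations along `ν`. -/
def IsLipschitzDomain (Ω : Set E3) : Prop :=
  IsOpen Ω ∧ Bornology.IsBounded Ω ∧ IsConnected Ω ∧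
    ∀ x ∈ frontier Ω, ∃ (ν : E3) (g : E3 → ℝ) (L : ℝ≥0) (r : ℝ),
      ‖ν‖ = 1 ∧ LipschitzWith L g ∧ (∀ (y : E3) (s : ℝ), g (y + s • ν) = g y) ∧ 0 < r ∧
        ∀ y ∈ Metric.ball x r, (y ∈ Ω ↔ ⟪ν, y⟫ < g y)

/-- A (conforming) triangulation of `Ω` by tetrahedra: a finite simplicial complex all of whose
simplices are faces of tetrahedra, and whose underlying space is the closure of `Ω`. As for every
`Geometry.SimplicialComplex`, a simplex is given by the finite set of its vertices. -/
structure Triangulation (Ω : Set E3) extends Geometry.SimplicialComplex ℝ E3 where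
  finite_faces : faces.Finite
  exists_tet : ∀ s ∈ faces, ∃ K ∈ faces, s ⊆ K ∧ K.card = 4
  space_eq : toSimplicialComplex.space = closure Ω

/-- The simplex with the given vertices, as a closed subset of space. -/
def body (s : Finset E3) : Set E3 := convexHull ℝ (s : Set E3)

/-- The diameter of a simplex (`h_K` for an element, `h_F` for a face). -/
def diam (s : Finset E3) : ℝ := Metric.diam (body s)

/-- The edges of an element. -/
def edgesOf (K : Finset E3) : Finset (Finset E3) := K.powersetCard 2

namespace Triangulation

variable {Ω : Set E3} (T : Triangulation Ω)

/-- The tetrahedra (elements) of the triangulation. -/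
def tets : Finset (Finset E3) := T.finite_faces.toFinset.filter fun s => s.card = 4

/-- The (triangular) faces of the triangulation. -/
def triangles : Finset (Finset E3) := T.finite_faces.toFinset.filter fun s => s.card = 3

/-- The edges of the triangulation. -/
def edges : Finset (Finset E3) := T.finite_faces.toFinset.filter fun s => s.card = 2

/-- Shape regularity with parameter `κ`: every element `K` contains a ball of diameter at least
`h_K / κ`. -/
def ShapeRegular (κ : ℝ) : Prop :=
  ∀ K ∈ T.tets, ∃ (x : E3) (r : ℝ), 0 < r ∧ Metric.closedBall x r ⊆ body K ∧
    diam K ≤ κ * (2 * r)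

/-- `F` is a boundary face: a face of exactly one element. -/
def IsBoundaryFace (F : Finset E3) : Prop :=
  F ∈ T.triangles ∧ ∃! K, K ∈ T.tets ∧ F ⊆ K

/-- `e` is a boundary edge: an edge of a boundary face. -/
def IsBoundaryEdge (e : Finset E3) : Prop :=
  e ∈ T.edges ∧ ∃ F, T.IsBoundaryFace F ∧ e ⊆ F

/-- Two different elements share a face. -/
def ShareFace (K K' : Finset E3) : Prop :=
  K ≠ K' ∧ ∃ F ∈ T.triangles, F ⊆ K ∧ F ⊆ K'

open Classical in
/-- The edge patch `ω_e`: all elements having `e` as an edge. -/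
def patch (e : Finset E3) : Finset (Finset E3) := T.tets.filter fun K => e ⊆ K

open Classical in
/-- The elements of the edge patch on which `μ⁻¹` is largest in the patch. -/
def maxPatch (μ : Finset E3 → ℝ) (e : Finset E3) : Finset (Finset E3) :=
  (T.patch e).filter fun K => ∀ K' ∈ T.patch e, (μ K')⁻¹ ≤ (μ K)⁻¹

open Classical in
/-- The elements of the edge patch on which `μ⁻¹` is smallest in the patch. -/
def minPatch (μ : Finset E3 → ℝ) (e : Finset E3) : Finset (Finset E3) :=
  (T.patch e).filter fun K => ∀ K' ∈ T.patch e, (μ K)⁻¹ ≤ (μ K')⁻¹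

open Classical in
/-- The interior faces of the edge patch `ω_e`: the faces shared by two elements of the patch. -/
def interiorFaces (e : Finset E3) : Finset (Finset E3) :=
  T.triangles.filter fun F => ∃ K ∈ T.patch e, ∃ K' ∈ T.patch e, K ≠ K' ∧ F ⊆ K ∧ F ⊆ K'

open Classical in
/-- The interior faces of the edge patch that are faces of an element with smallest `μ⁻¹`. -/
def minFaces (μ : Finset E3 → ℝ) (e : Finset E3) : Finset (Finset E3) :=
  (T.interiorFaces e).filter fun F => ∃ K ∈ T.minPatch μ e, F ⊆ K

/-! ### Quasi-monotonicity of `μ⁻¹` on the edge patches -/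

/-- There are `K = K₀, K₁, …, K_l = K'` in the edge patch of `e` such that `K_{i-1}` and `K_i` share
a face and `μ⁻¹` does not decrease from `K_{i-1}` to `K_i`. -/
def MonotonePath (μ : Finset E3 → ℝ) (e K K' : Finset E3) : Prop :=
  Relation.ReflTransGen
    (fun L L' => L ∈ T.patch e ∧ L' ∈ T.patch e ∧ T.ShareFace L L' ∧ (μ L)⁻¹ ≤ (μ L')⁻¹) K K'

/-- Quasi-monotonicity of `μ⁻¹` in the edge patches. Around an interior edge, each element of the
patch is joined by a monotone path to each element with maximal `μ⁻¹`. Around a boundary edge, this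
is required of the elements where `μ⁻¹` is not maximal, and moreover one of the boundary faces that
contain the edge belongs to an element with maximal `μ⁻¹`. -/
def QuasiMonotone (μ : Finset E3 → ℝ) : Prop :=
  ∀ e ∈ T.edges,
    (¬ T.IsBoundaryEdge e →
      ∀ K ∈ T.patch e, ∀ K' ∈ T.maxPatch μ e, T.MonotonePath μ e K K') ∧
    (T.IsBoundaryEdge e →
      (∀ K ∈ T.patch e, K ∉ T.maxPatch μ e → ∀ K' ∈ T.maxPatch μ e, T.MonotonePath μ e K K') ∧
      ∃ F, T.IsBoundaryFace F ∧ e ⊆ F ∧ ∃ K ∈ T.maxPatch μ e, F ⊆ K)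

/-! ### Normals, tangents and the elements on both sides of a face -/

/-- `n` assigns to every face a unit normal vector. -/
def IsUnitNormal (n : Finset E3 → E3) : Prop :=
  ∀ F ∈ T.triangles, ‖n F‖ = 1 ∧ ∀ p ∈ F, ∀ q ∈ F, ⟪n F, q - p⟫ = 0

/-- `t` assigns to every edge a unit tangent vector. -/
def IsUnitTangent (t : Finset E3 → E3) : Prop :=
  ∀ e ∈ T.edges, ‖t e‖ = 1 ∧ ∀ p ∈ e, ∀ q ∈ e, ∃ c : ℝ, q - p = c • t e

/-- The element `K₋` at the face `F`: the one for which `n F` points outward. It is only used at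
faces shared by two elements, where it exists and is unique. -/
def elemMinus (n : Finset E3 → E3) (F : Finset E3) : Finset E3 :=
  Classical.epsilon fun K => K ∈ T.tets ∧ F ⊆ K ∧ ∀ z ∈ K, z ∉ F → ∀ p ∈ F, ⟪n F, z - p⟫ < 0

/-- The element `K₊` at the face `F`: the one for which `n F` points inward. It is only used at
faces shared by two elements, where it exists and is unique. -/
def elemPlus (n : Finset E3 → E3) (F : Finset E3) : Finset E3 :=
  Classical.epsilon fun K => K ∈ T.tets ∧ F ⊆ K ∧ ∀ z ∈ K, z ∉ F → ∀ p ∈ F, 0 < ⟪n F, z - p⟫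

end Triangulation

/-! ### The lowest order Nédélec element -/

/-- `p` belongs to the local Nédélec space: `p(x) = a + b × x`. -/
def IsNedelecPoly (p : E3 → E3) : Prop := ∃ a b : E3, ∀ x, p x = a + cross b x

/-- The field on space that equals `u K` in the interior of each element `K`. -/
def Triangulation.glue {Ω : Set E3} (T : Triangulation Ω) (u : Finset E3 → E3 → E3) : E3 → E3 :=
  fun x => ∑ K ∈ T.tets, (interior (body K)).indicator (u K) x

/-- The family `u` of local fields (`u K` is the restriction to `K`) belongs to the global Nédélec
space: the restrictions lie in the local spaces and the glued field lies in `H(curl; Ω)`. -/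
def Triangulation.IsNedelec {Ω : Set E3} (T : Triangulation Ω) (u : Finset E3 → E3 → E3) : Prop :=
  (∀ K ∈ T.tets, IsNedelecPoly (u K)) ∧ InHCurl Ω (T.glue u)

/-- The barycentric coordinate of the tetrahedron `K` at its vertex `z`: the affine function that
is `1` at `z` and `0` at the other vertices. -/
def bary (K : Finset E3) (z : E3) : E3 →ᵃ[ℝ] ℝ :=
  Classical.epsilon fun f => f z = 1 ∧ ∀ w ∈ K, w ≠ z → f w = 0

open Classical in
/-- The Nédélec nodal basis function of the edge `e = {z, w}` on the tetrahedron `K`,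
`λ_z ∇λ_w / (t_e · ∇λ_w) + λ_w ∇λ_z / (t_e · ∇λ_z)`. Since `∇λ_w` is a multiple of the normal `n_w`
of the face opposite to `w`, this is `λ_z n_w / (t_e · n_w) + λ_w n_z / (t_e · n_z)`; its tangential
component is `1` on `e` and `0` on the other edges of `K`. -/
def nedelecBasis (t : Finset E3 → E3) (K e : Finset E3) (x : E3) : E3 :=
  ∑ z ∈ e, ∑ w ∈ e.erase z,
    (bary K z x / ⟪t e, gradient (bary K w) x⟫) • gradient (bary K w) x

/-! ### The recovery and the indicator -/

namespace Triangulation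

variable {Ω : Set E3} (T : Triangulation Ω)

/-- The area of a face. -/
def area (F : Finset E3) : ℝ := μHE[2].real (body F)

/-- The numerical magnetic field intensity `σ_{h,K} = μ_K⁻¹ ∇×u_h` on the element `K`. -/
def sigma (μ : Finset E3 → ℝ) (u : Finset E3 → E3 → E3) (K : Finset E3) (x : E3) : E3 :=
  (μ K)⁻¹ • curl (u K) x

/-- The weight `γ_F⁻ = μ_{K₊}^{-1/2} / (μ_{K₋}^{-1/2} + μ_{K₊}^{-1/2})` of an interior face. -/
def gammaMinus (μ : Finset E3 → ℝ) (n : Finset E3 → E3) (F : Finset E3) : ℝ :=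
  (√(μ (T.elemPlus n F)))⁻¹ / ((√(μ (T.elemMinus n F)))⁻¹ + (√(μ (T.elemPlus n F)))⁻¹)

/-- The weighted average `σ_{h,F} = γ_F⁻ σ_{h,K₋} + (1 - γ_F⁻) σ_{h,K₊}` on an interior face. -/
def sigmaFace (μ : Finset E3 → ℝ) (n : Finset E3 → E3) (u : Finset E3 → E3 → E3)
    (F : Finset E3) (x : E3) : E3 :=
  T.gammaMinus μ n F • sigma μ u (T.elemMinus n F) x +
    (1 - T.gammaMinus μ n F) • sigma μ u (T.elemPlus n F) x

/-- The degree of freedom of the recovered field at the edge `e`: the average of `σ_{h,F} · t_e`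
over the interior faces of the edge patch next to the elements with smallest `μ⁻¹`. -/
def recoveryDof (μ : Finset E3 → ℝ) (n t : Finset E3 → E3) (u : Finset E3 → E3 → E3)
    (e : Finset E3) : ℝ :=
  ∑ F ∈ T.minFaces μ e,
    (∑ F' ∈ T.minFaces μ e, area F')⁻¹ * ∫ x in body F, ⟪T.sigmaFace μ n u F x, t e⟫ ∂μHE[2]

/-- The recovered field `σ*_h` on the element `K`. -/
def recovered (μ : Finset E3 → ℝ) (n t : Finset E3 → E3) (u : Finset E3 → E3 → E3)
    (K : Finset E3) (x : E3) : E3 :=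
  ∑ e ∈ edgesOf K, T.recoveryDof μ n t u e • nedelecBasis t K e x

/-- The curl-recovery indicator `η_{K,⊥} = ‖μ^{1/2} σ*_h - μ^{-1/2} ∇×u_h‖_{L²(K)}`. -/
def etaPerp (μ : Finset E3 → ℝ) (n t : Finset E3 → E3) (u : Finset E3 → E3 → E3)
    (K : Finset E3) : ℝ :=
  √(∫ x in body K, ‖√(μ K) • T.recovered μ n t u K x - (√(μ K))⁻¹ • curl (u K) x‖ ^ 2)

/-- The face coefficient `μ_F`, where `μ_F⁻¹` is the arithmetic mean of `μ_{K₋}⁻¹` and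
`μ_{K₊}⁻¹`. -/
def muFace (μ : Finset E3 → ℝ) (n : Finset E3 → E3) (F : Finset E3) : ℝ :=
  (((μ (T.elemMinus n F))⁻¹ + (μ (T.elemPlus n F))⁻¹) / 2)⁻¹

/-- The jump `⟦(μ⁻¹ ∇×u_h) × n⟧_F`, the value from `K₋` minus the value from `K₊`. -/
def tangentialJump (μ : Finset E3 → ℝ) (n : Finset E3 → E3) (u : Finset E3 → E3 → E3)
    (F : Finset E3) (x : E3) : E3 :=
  cross (sigma μ u (T.elemMinus n F) x) (n F) - cross (sigma μ u (T.elemPlus n F) x) (n F)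

/-- The norm `‖μ_F^{1/2} ⟦(μ⁻¹ ∇×u_h) × n⟧_F‖_{L²(F)}`. -/
def jumpNorm (μ : Finset E3 → ℝ) (n : Finset E3 → E3) (u : Finset E3 → E3 → E3)
    (F : Finset E3) : ℝ :=
  √(∫ x in body F, ‖√(T.muFace μ n F) • T.tangentialJump μ n u F x‖ ^ 2 ∂μHE[2])

end Triangulation

end EdgeRecovery

end

open EdgeRecovery

/-! On each element `curl u` is constant, so `σ_K = μ_K⁻¹ curl u` is a constant field, which the
Nédélec basis reproduces from its edge components `s_K = σ_K · t_e`. The error on `K` is therefore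
`√μ_K ∑_e (dof_e - s_K) φ_e` with `|φ_e| ≤ 2κ`. Everything reduces to bounding `√μ_K |dof_e - s_K|`
by twice the sum of `√μ_F |s_{K₋} - s_{K₊}|` over the interior faces of the patch
(`QuasiMonotone.sqrt_mul_abs_recoveryDof_sub_le`); shape regularity supplies the powers of `h_F`.

The degree of freedom is an area-weighted mean of face averages next to elements `K₁` with smallest
`μ⁻¹`. The weights `γ_F` are such that each average differs from `s_{K₁}` by at most one weighted
jump, even after multiplication by `√μ_{K₁} ≥ √μ_K`. It remains to compare `s_K` with `s_{K₁}`. A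
face absorbs the factor `√μ_K` into `√μ_F` as soon as `μ⁻¹ ≤ μ_K⁻¹` on both its sides, so what is
needed is a path from `K` to `K₁` inside the sublevel set `{μ⁻¹ ≤ μ_K⁻¹}`
(`QuasiMonotone.sublevel_connected`).

Walking around the edge is modelled by two involutions on flags (element, face through `e`). Around
an interior edge the elements form a cycle. Cut it at a maximal element: if the arc from `K` to `K₁`
contained a value above `μ_K⁻¹`, a monotone path starting there could never leave the arc, hence
never reach the maximum. Around a boundary edge the walk starts at a maximal element on the
boundary, and `μ⁻¹` cannot increase along it on the way to a nonmaximal element. If `K` itself is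
maximal, the sublevel set is the whole patch; at a boundary edge its connectedness through faces
comes from the Lipschitz boundary (`patch_connected`). -/

namespace EdgeRecovery

/-! ### Walking around an edge -/

section Flags

variable {X V : Type*} {τ ρ : X → X} {π : X → V} {v : V → ℝ}

/-- If two involutions have no fixed points, then rotating a point by their product never leads to
its mirror image. -/
theorem iterate_ne_reflect (hρ : Function.Involutive ρ) (hτ : Function.Involutive τ)
    (hρx : ∀ x, ρ x ≠ x) (hτx : ∀ x, τ x ≠ x) (m : ℕ) (x : X) : (ρ ∘ τ)^[m] x ≠ ρ x := by
  induction m using Nat.twoStepInduction generalizing x with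
  | zero => exact fun h => hρx x h.symm
  | one => exact fun h => hτx x (hρ.injective (by simpa using h))
  | more m ih _ =>
    intro h
    -- In the dihedral group generated by `ρ` and `τ`, the relation for `m + 2` at `x` is the
    -- relation for `m` at `ρ (τ x)`.
    refine ih ((ρ ∘ τ) x) ?_
    rw [Function.iterate_succ_apply, Function.iterate_succ_apply'] at h
    have h1 := hρ.injective h
    rw [Function.comp_apply, hρ]
    exact hτ.injective (by rw [hτ]; exact h1)

variable (τ π) in
/-- Two elements are adjacent if some flag leads from one to the other. -/
def FlagAdj (A B : V) : Prop := ∃ x, π x = A ∧ π (τ x) = B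

theorem FlagAdj.symm (hτ : Function.Involutive τ) {A B : V} (h : FlagAdj τ π A B) :
    FlagAdj τ π B A := by
  obtain ⟨x, rfl, rfl⟩ := h
  exact ⟨τ x, rfl, by rw [hτ]⟩

variable (τ π v) in
/-- Adjacency within the sublevel set `v ≤ a`. -/
def SublevelAdj (a : ℝ) (A B : V) : Prop := FlagAdj τ π A B ∧ v A ≤ a ∧ v B ≤ a

theorem SublevelAdj.symm (hτ : Function.Involutive τ) {a : ℝ} {A B : V}
    (h : SublevelAdj τ π v a A B) : SublevelAdj τ π v a B A :=
  ⟨h.1.symm hτ, h.2.2, h.2.1⟩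

theorem reflTransGen_sublevel_of_le {s : ℕ → X} (hs : ∀ i, π (s (i + 1)) = π (τ (s i))) {a : ℝ}
    {i j : ℕ} (hij : i ≤ j) (h : ∀ l, i ≤ l → l ≤ j → v (π (s l)) ≤ a) :
    Relation.ReflTransGen (SublevelAdj τ π v a) (π (s i)) (π (s j)) := by
  induction j, hij using Nat.le_induction with
  | base => exact .refl
  | succ j hij ih =>
    exact (ih fun l h1 h2 => h l h1 (by lia)).tail
      ⟨⟨s j, rfl, (hs j).symm⟩, h j hij (by lia), h (j + 1) (by lia) le_rfl⟩

theorem reflTransGen_sublevel (hτ : Function.Involutive τ) {s : ℕ → X}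
    (hs : ∀ i, π (s (i + 1)) = π (τ (s i))) {a : ℝ} {i j : ℕ}
    (h : ∀ l, min i j ≤ l → l ≤ max i j → v (π (s l)) ≤ a) :
    Relation.ReflTransGen (SublevelAdj τ π v a) (π (s i)) (π (s j)) := by
  rcases le_total i j with hij | hij
  · exact reflTransGen_sublevel_of_le hs hij fun l h1 h2 => h l (by lia) (by lia)
  · have : Std.Symm (SublevelAdj τ π v a) := ⟨fun _ _ h => h.symm hτ⟩
    exact Std.Symm.symm _ _ <|
      reflTransGen_sublevel_of_le hs hij fun l h1 h2 => h l (by lia) (by lia)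

variable (hρ : Function.Involutive ρ) (hτ : Function.Involutive τ)
  (hπρ : ∀ x, π (ρ x) = π x) (hπ : ∀ x y, π x = π y → y = x ∨ y = ρ x)

include hρ hτ hπρ hπ

/-- An element carries at most the two flags `x` and `ρ x`, so its neighbours are the next and the
previous element of the walk. The walk has no index `-1`: at `i = 0` the previous element is the one
behind `ρ x₀`. -/
theorem flagAdj_iterate {x₀ : X} {i : ℕ} {A : V}
    (h : FlagAdj τ π (π ((ρ ∘ τ)^[i] x₀)) A) :
    A = π ((ρ ∘ τ)^[i + 1] x₀) ∨ (∃ j, i = j + 1 ∧ A = π ((ρ ∘ τ)^[j] x₀)) ∨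
      (i = 0 ∧ A = π (τ (ρ x₀))) := by
  obtain ⟨y, hy, rfl⟩ := h
  rcases hπ _ _ hy.symm with rfl | rfl
  · left
    rw [Function.iterate_succ_apply', Function.comp_apply, hπρ]
  · right
    rcases i with _ | j
    · exact .inr ⟨rfl, rfl⟩
    · refine .inl ⟨j, rfl, ?_⟩
      rw [Function.iterate_succ_apply', Function.comp_apply, hρ, hτ]

/-- Sublevel sets are connected around a boundary edge, if the walk starts at the boundary from an
element that monotone paths lead to. -/
theorem sublevel_connected_of_boundary {x₀ : X} (hx₀ : τ (ρ x₀) = ρ x₀) {K L : V}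
    (hK : Relation.ReflTransGen (fun A B => FlagAdj τ π A B ∧ v A ≤ v B) K (π x₀))
    (hL : Relation.ReflTransGen (fun A B => FlagAdj τ π A B ∧ v A ≤ v B) L (π x₀))
    (hLK : v L ≤ v K) : Relation.ReflTransGen (SublevelAdj τ π v (v K)) K L := by
  set s : ℕ → X := fun i => (ρ ∘ τ)^[i] x₀ with hsdef
  have hs : ∀ i, π (s (i + 1)) = π (τ (s i)) := fun i => by
    simp only [hsdef]
    rw [Function.iterate_succ_apply', Function.comp_apply, hπρ]
  -- Read backwards from `π x₀`, each step of a monotone path extends the walk to an element with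
  -- smaller or equal value, retreats on it, or, at index `0`, stays put because `ρ x₀` lies on the
  -- boundary.
  have key : ∀ K, Relation.ReflTransGen (fun A B => FlagAdj τ π A B ∧ v A ≤ v B) K (π x₀) →
      ∃ i, π (s i) = K ∧ ∀ k < i, v (π (s (k + 1))) ≤ v (π (s k)) := by
    intro K hK
    induction hK using Relation.ReflTransGen.head_induction_on with
    | refl => exact ⟨0, rfl, by simp⟩
    | head hab _ ih =>
      obtain ⟨i, rfl, hi⟩ := ih
      rcases flagAdj_iterate hρ hτ hπρ hπ (hab.1.symm hτ) with rfl | ⟨j, rfl, rfl⟩ | ⟨rfl, rfl⟩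
      · refine ⟨i + 1, rfl, fun k hk => ?_⟩
        rcases Nat.lt_succ_iff_lt_or_eq.mp hk with hk | rfl
        · exact hi k hk
        · exact hab.2
      · exact ⟨j, rfl, fun k hk => hi k (by lia)⟩
      · exact ⟨0, by rw [hx₀, hπρ]; rfl, by simp⟩
  obtain ⟨i, rfl, hi⟩ := key K hK
  obtain ⟨j, rfl, hj⟩ := key L hL
  have anti : ∀ i, (∀ k < i, v (π (s (k + 1))) ≤ v (π (s k))) → ∀ k l, k ≤ l → l ≤ i →
      v (π (s l)) ≤ v (π (s k)) := by
    intro i hi k l hkl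
    induction l, hkl using Nat.le_induction with
    | base => exact fun _ => le_rfl
    | succ l hkl ih => exact fun hl => (hi l (by lia)).trans (ih (by lia))
  refine reflTransGen_sublevel hτ hs fun l h1 h2 => ?_
  rcases le_total i j with hij | hij
  · exact anti j hj i l (by lia) (by lia)
  · exact (anti i hi j l (by lia) (by lia)).trans hLK

/-- Sublevel sets are connected around an interior edge, if monotone paths lead from everywhere to
one element. -/
theorem sublevel_connected_of_interior [Finite X] (hρx : ∀ x, ρ x ≠ x) (hτx : ∀ x, τ x ≠ x) {x₀ : X}
    (hM : ∀ x, Relation.ReflTransGen (fun A B => FlagAdj τ π A B ∧ v A ≤ v B) (π x) (π x₀))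
    {x y : X} (hyx : v (π y) ≤ v (π x)) :
    Relation.ReflTransGen (SublevelAdj τ π v (v (π x))) (π x) (π y) := by
  set s : ℕ → X := fun i => (ρ ∘ τ)^[i] x₀ with hsdef
  have hs : ∀ i, π (s (i + 1)) = π (τ (s i)) := fun i => by
    simp only [hsdef]
    rw [Function.iterate_succ_apply', Function.comp_apply, hπρ]
  have hper : x₀ ∈ Function.periodicPts (ρ ∘ τ) :=
    (hρ.injective.comp hτ.injective).mem_periodicPts x₀
  set N := Function.minimalPeriod (ρ ∘ τ) x₀ with hN
  have hN0 : 0 < N := Function.minimalPeriod_pos_of_mem_periodicPts hper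
  have hsN : s N = x₀ := Function.iterate_minimalPeriod
  have hmod : ∀ i, s (i % N) = s i := fun i => Function.iterate_mod_minimalPeriod_eq
  have key : ∀ x, ∃ i < N, π (s i) = π x := by
    suffices h : ∀ K, Relation.ReflTransGen (fun A B => FlagAdj τ π A B ∧ v A ≤ v B) K (π x₀) →
        ∃ i, π (s i) = K by
      intro x
      obtain ⟨i, hi⟩ := h _ (hM x)
      exact ⟨i % N, Nat.mod_lt _ hN0, by rw [hmod, hi]⟩
    intro K hK
    induction hK using Relation.ReflTransGen.head_induction_on with
    | refl => exact ⟨0, rfl⟩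
    | head hab _ ih =>
      obtain ⟨i, rfl⟩ := ih
      rcases flagAdj_iterate hρ hτ hπρ hπ (hab.1.symm hτ) with rfl | ⟨j, rfl, rfl⟩ | ⟨rfl, rfl⟩
      · exact ⟨i + 1, rfl⟩
      · exact ⟨j, rfl⟩
      -- Since `x₀ = s N = ρ (τ (s (N - 1)))`, the element behind `ρ x₀` is the last one of the
      -- cycle.
      · refine ⟨N - 1, ?_⟩
        have h1 : s N = (ρ ∘ τ) (s (N - 1)) := by
          rw [← Function.iterate_succ_apply' (ρ ∘ τ), Nat.succ_eq_add_one, Nat.sub_add_cancel hN0]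
        rw [hsN] at h1
        rw [h1, Function.comp_apply, hρ, hτ]
  obtain ⟨i, hi, hix⟩ := key x
  obtain ⟨j, hj, hjy⟩ := key y
  rw [← hix, ← hjy] at hyx ⊢
  refine reflTransGen_sublevel hτ hs fun l h1 h2 => ?_
  by_contra! hl
  -- Values along a monotone path do not decrease, so a path that starts above `v (π (s i))` cannot
  -- pass the ends of the arc, where `v` is at most that. It reaches `π x₀` strictly inside the arc.
  have inside : ∀ L, Relation.ReflTransGen (fun A B => FlagAdj τ π A B ∧ v A ≤ v B) L (π x₀) →
      ∀ l, min i j ≤ l → l ≤ max i j → v (π (s i)) < v L → π (s l) = L →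
      ∃ l, min i j < l ∧ l < max i j ∧ π (s l) = π x₀ := by
    have strict : ∀ l, min i j ≤ l → l ≤ max i j → v (π (s i)) < v (π (s l)) →
        min i j < l ∧ l < max i j := by
      intro l h1 h2 h3
      have hli : l ≠ i := by rintro rfl; exact lt_irrefl _ h3
      have hlj : l ≠ j := by rintro rfl; exact lt_irrefl _ (h3.trans_le hyx)
      lia
    intro L hL
    induction hL using Relation.ReflTransGen.head_induction_on with
    | refl =>
      rintro l h1 h2 h3 h4
      obtain ⟨h5, h6⟩ := strict l h1 h2 (h4 ▸ h3)
      exact ⟨l, h5, h6, h4⟩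
    | head hab _ ih =>
      rintro l h1 h2 h3 rfl
      obtain ⟨h5, h6⟩ := strict l h1 h2 h3
      rcases flagAdj_iterate hρ hτ hπρ hπ hab.1 with rfl | ⟨k, rfl, rfl⟩ | ⟨rfl, rfl⟩
      · exact ih (l + 1) (by lia) (by lia) (h3.trans_le hab.2) rfl
      · exact ih k (by lia) (by lia) (h3.trans_le hab.2) rfl
      · lia
  obtain ⟨l', h3, h4, h5⟩ := inside _ (hM (s l)) l h1 h2 hl rfl
  -- With `0 < l' < N`, the flag `s l'` can be neither `x₀`, by minimality of the period, nor `ρ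
  -- x₀`.
  rcases hπ _ _ h5.symm with h6 | h6
  · exact Function.not_isPeriodicPt_of_pos_of_lt_minimalPeriod (f := ρ ∘ τ) (x := x₀)
      (n := l') (by lia) (by lia) h6
  · exact iterate_ne_reflect hρ hτ hρx hτx l' x₀ h6

end Flags

/-! ### Barycentric coordinates of a tetrahedron -/

/-- A nondegenerate tetrahedron, given by its vertices. -/
def IsTetrahedron (K : Finset E3) : Prop :=
  K.card = 4 ∧ AffineIndependent ℝ ((↑) : K → E3)

namespace IsTetrahedron

variable {K : Finset E3}

theorem exists_basis (hK : IsTetrahedron K) :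
    ∃ b : AffineBasis K ℝ E3, ∀ z : K, b z = z := by
  refine ⟨⟨((↑) : K → E3), hK.2, ?_⟩, fun z => rfl⟩
  rw [hK.2.affineSpan_eq_top_iff_card_eq_finrank_add_one]
  simp [hK.1]

/-- Vertex values determine an affine function, which identifies the function chosen by `epsilon` in
`bary`. -/
theorem exists_bary_eq_coord (hK : IsTetrahedron K) :
    ∃ b : AffineBasis K ℝ E3, (∀ z : K, b z = z) ∧ ∀ z : K, bary K z = b.coord z := by
  classical
  obtain ⟨b, hb⟩ := hK.exists_basis
  refine ⟨b, hb, fun z => ?_⟩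
  have hspec : bary K z z = 1 ∧ ∀ w ∈ K, w ≠ z → bary K z w = 0 := by
    refine Classical.epsilon_spec
      (p := fun f : E3 →ᵃ[ℝ] ℝ => f z = 1 ∧ ∀ w ∈ K, w ≠ (z : E3) → f w = 0) ⟨b.coord z, ?_, ?_⟩
    · rw [← hb z]; exact b.coord_apply_eq z
    · intro w hw hwz
      have := hb ⟨w, hw⟩
      simp only at this
      rw [← this]
      exact b.coord_apply_ne (fun h => hwz (by rw [h]))
  refine AffineMap.ext_on b.tot ?_
  rintro _ ⟨w, rfl⟩
  rw [b.coord_apply, hb]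
  split_ifs with h
  · rw [← h]; exact hspec.1
  · exact hspec.2 w w.2 (fun h' => h (Subtype.ext h'.symm))

theorem bary_self (hK : IsTetrahedron K) {z : E3} (hz : z ∈ K) : bary K z z = 1 := by
  obtain ⟨b, hb, h⟩ := hK.exists_bary_eq_coord
  have := b.coord_apply_eq ⟨z, hz⟩
  rwa [← h, hb] at this

theorem bary_ne (hK : IsTetrahedron K) {z w : E3} (hz : z ∈ K) (hw : w ∈ K) (hwz : w ≠ z) :
    bary K z w = 0 := by
  obtain ⟨b, hb, h⟩ := hK.exists_bary_eq_coord
  have := b.coord_apply_ne (i := ⟨z, hz⟩) (j := ⟨w, hw⟩) (fun h => hwz (by simpa using h.symm))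
  rwa [← h, hb] at this

theorem sum_bary (hK : IsTetrahedron K) (x : E3) : ∑ z ∈ K, bary K z x = 1 := by
  obtain ⟨b, hb, h⟩ := hK.exists_bary_eq_coord
  rw [← b.sum_coord_apply_eq_one x, ← Finset.sum_coe_sort]
  exact Finset.sum_congr rfl fun z _ => by rw [h]

theorem sum_bary_smul (hK : IsTetrahedron K) (x : E3) : ∑ z ∈ K, bary K z x • z = x := by
  obtain ⟨b, hb, h⟩ := hK.exists_bary_eq_coord
  conv_rhs => rw [← b.linear_combination_coord_eq_self x]
  rw [← Finset.sum_coe_sort]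
  exact Finset.sum_congr rfl fun z _ => by rw [h, hb]

theorem mem_body_face_iff (hK : IsTetrahedron K) {F : Finset E3} (hF : F ⊆ K) {x : E3} :
    x ∈ body F ↔ (∀ z ∈ K, 0 ≤ bary K z x) ∧ ∀ z ∈ K, z ∉ F → bary K z x = 0 := by
  constructor
  · intro hx
    have hconv : Convex ℝ {x | (∀ z ∈ K, 0 ≤ bary K z x) ∧ ∀ z ∈ K, z ∉ F → bary K z x = 0} := by
      intro x hx y hy a b ha hb hab
      have h : ∀ z, bary K z (a • x + b • y) = a * bary K z x + b * bary K z y := fun z => by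
        rw [Convex.combo_affine_apply hab]; rfl
      refine ⟨fun z hz => ?_, fun z hz hzF => ?_⟩
      · rw [h]
        have := hx.1 z hz
        have := hy.1 z hz
        positivity
      · rw [h, hx.2 z hz hzF, hy.2 z hz hzF]; ring
    refine convexHull_min ?_ hconv hx
    intro w hw
    refine ⟨fun z hz => ?_, fun z hz hzF => ?_⟩
    · by_cases h : w = z
      · subst h; rw [hK.bary_self hz]; exact zero_le_one
      · rw [hK.bary_ne hz (hF hw) h]
    · exact hK.bary_ne hz (hF hw) (fun h => hzF (h ▸ hw))
  · rintro ⟨h1, h2⟩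
    have hs : ∑ z ∈ F, bary K z x = 1 := by
      rw [← hK.sum_bary x]
      exact Finset.sum_subset hF h2
    have hx : ∑ z ∈ F, bary K z x • z = x := by
      conv_rhs => rw [← hK.sum_bary_smul x]
      exact Finset.sum_subset hF fun z hz hzF => by rw [h2 z hz hzF, zero_smul]
    rw [← hx]
    exact (convex_convexHull ℝ _).sum_mem (fun z hz => h1 z (hF hz)) hs
      fun z hz => subset_convexHull ℝ _ hz

theorem mem_body_iff (hK : IsTetrahedron K) {x : E3} :
    x ∈ body K ↔ ∀ z ∈ K, 0 ≤ bary K z x := by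
  rw [hK.mem_body_face_iff subset_rfl]
  exact ⟨fun h => h.1, fun h => ⟨h, fun z hz hz' => absurd hz hz'⟩⟩

theorem bary_le_one (hK : IsTetrahedron K) {x : E3} (hx : x ∈ body K) {z : E3} (hz : z ∈ K) :
    bary K z x ≤ 1 := by
  rw [← hK.sum_bary x]
  exact Finset.single_le_sum (f := fun z => bary K z x) (hK.mem_body_iff.mp hx) hz

theorem mem_interior_body_iff (hK : IsTetrahedron K) {x : E3} :
    x ∈ interior (body K) ↔ ∀ z ∈ K, 0 < bary K z x := by
  obtain ⟨b, hb, h⟩ := hK.exists_bary_eq_coord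
  have hr : range b = (K : Set E3) := by
    ext w
    simp [hb]
  rw [body, ← hr, b.interior_convexHull]
  simp only [mem_ofPred_eq, Subtype.forall]
  exact forall₂_congr fun z hz => by rw [← h]

end IsTetrahedron

theorem body_mono {s t : Finset E3} (h : s ⊆ t) : body s ⊆ body t :=
  convexHull_mono (by exact_mod_cast h)

theorem isCompact_body (s : Finset E3) : IsCompact (body s) :=
  s.finite_toSet.isCompact_convexHull ℝ

theorem dist_le_diam {s : Finset E3} {x y : E3} (hx : x ∈ body s) (hy : y ∈ body s) :
    dist x y ≤ diam s :=
  Metric.dist_le_diam_of_mem (isCompact_body s).isBounded hx hy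

theorem diam_nonneg (s : Finset E3) : 0 ≤ diam s := Metric.diam_nonneg

theorem diam_mono {s t : Finset E3} (h : s ⊆ t) : diam s ≤ diam t :=
  Metric.diam_mono (body_mono h) (isCompact_body t).isBounded

theorem mem_body {s : Finset E3} {z : E3} (hz : z ∈ s) : z ∈ body s :=
  subset_convexHull ℝ _ (by exact_mod_cast hz)

/-! ### Gradients and Nédélec basis functions -/

theorem inner_gradient_affine (f : E3 →ᵃ[ℝ] ℝ) (x v : E3) : ⟪gradient f x, v⟫ = f.linear v := by
  rw [gradient, InnerProductSpace.toDual_symm_apply]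
  have h : (f : E3 → ℝ) = fun y => LinearMap.toContinuousLinearMap f.linear y + f 0 := by
    funext y
    simpa using congrFun f.decomp y
  rw [h, fderiv_add_const, ContinuousLinearMap.fderiv]
  rfl

theorem inner_gradient_affine_sub (f : E3 →ᵃ[ℝ] ℝ) (x y z : E3) :
    ⟪gradient f x, y - z⟫ = f y - f z := by
  rw [inner_gradient_affine]
  exact f.linearMap_vsub y z

/-- Compare the values at the two ends of the diameter parallel to the gradient: they differ by
`2r‖∇f‖`. -/
theorem norm_gradient_affine_le {f : E3 →ᵃ[ℝ] ℝ} {c : E3} {r : ℝ} (hr : 0 < r)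
    (h : ∀ y ∈ Metric.closedBall c r, 0 ≤ f y ∧ f y ≤ 1) (x : E3) :
    ‖gradient f x‖ * (2 * r) ≤ 1 := by
  set g := gradient f x with hg
  rcases eq_or_ne g 0 with h0 | h0
  · rw [h0]; simp
  have hn : 0 < ‖g‖ := norm_pos_iff.mpr h0
  have hy : ∀ s : ℝ, |s| = r → c + (s / ‖g‖) • g ∈ Metric.closedBall c r := fun s hs => by
    rw [mem_closedBall_iff_norm, add_sub_cancel_left, norm_smul, Real.norm_eq_abs, abs_div,
      abs_norm, div_mul_cancel₀ _ hn.ne', hs]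
  have h1 := (h _ (hy r (abs_of_pos hr))).2
  have h2 := (h _ (hy (-r) (by rw [abs_neg, abs_of_pos hr]))).1
  have h3 := inner_gradient_affine_sub f x (c + (r / ‖g‖) • g) (c + (-r / ‖g‖) • g)
  rw [add_sub_add_left_eq_sub, ← sub_smul, real_inner_smul_right, ← hg,
    real_inner_self_eq_norm_sq] at h3
  have h4 : (r / ‖g‖ - -r / ‖g‖) * ‖g‖ ^ 2 = ‖g‖ * (2 * r) := by
    field_simp
    ring
  linarith

/-- A unit tangent of the segment from `z` to `w` is `± (w - z) / ‖w - z‖`. -/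
theorem exists_tangent_eq {t z w : E3} (ht : ‖t‖ = 1) (hzw : ∃ c : ℝ, w - z = c • t)
    (hne : z ≠ w) : ∃ c : ℝ, c ≠ 0 ∧ |c| = ‖w - z‖ ∧ t = c⁻¹ • (w - z) := by
  obtain ⟨c, hc⟩ := hzw
  have h0 : c ≠ 0 := by
    rintro rfl
    rw [zero_smul, sub_eq_zero] at hc
    exact hne hc.symm
  exact ⟨c, h0, by rw [hc, norm_smul, ht, mul_one, Real.norm_eq_abs],
    by rw [hc, smul_smul, inv_mul_cancel₀ h0, one_smul]⟩

theorem nedelecBasis_pair (t : Finset E3 → E3) (K : Finset E3) {z w : E3} (h : z ≠ w) (x : E3) :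
    nedelecBasis t K {z, w} x =
      (bary K z x / ⟪t {z, w}, gradient (bary K w) x⟫) • gradient (bary K w) x +
      (bary K w x / ⟪t {z, w}, gradient (bary K z) x⟫) • gradient (bary K z) x := by
  have h1 : ∀ inst : DecidableEq E3, @Finset.erase _ inst {z, w} z = {w} := by
    intro inst; ext; simp; grind
  have h2 : ∀ inst : DecidableEq E3, @Finset.erase _ inst {z, w} w = {z} := by
    intro inst; ext; simp; grind
  rw [nedelecBasis, Finset.sum_pair h, h1, h2, Finset.sum_singleton, Finset.sum_singleton]

namespace IsTetrahedron

variable {K : Finset E3}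

theorem inner_tangent_gradient (hK : IsTetrahedron K) {t z w : E3} {c : ℝ} (hz : z ∈ K)
    (hw : w ∈ K) (hne : z ≠ w) (ht : t = c⁻¹ • (w - z)) (x : E3) :
    ⟪t, gradient (bary K w) x⟫ = c⁻¹ := by
  rw [ht, real_inner_smul_left, real_inner_comm, inner_gradient_affine_sub, hK.bary_self hw,
    hK.bary_ne hw hz hne]
  ring

/-- With `c` the signed edge length, `t · ∇λ_w = 1/c` and `t · ∇λ_z = -1/c`, so the basis function
takes the Whitney form `c (λ_z ∇λ_w - λ_w ∇λ_z)`. -/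
theorem smul_nedelecBasis_pair (hK : IsTetrahedron K) {t : Finset E3 → E3} {z w : E3} (hz : z ∈ K)
    (hw : w ∈ K) (hne : z ≠ w) (ht : ‖t {z, w}‖ = 1) (hzw : ∃ c : ℝ, w - z = c • t {z, w})
    (a : ℝ) (x : E3) :
    ∃ c : ℝ, c ≠ 0 ∧ |c| = ‖w - z‖ ∧ t {z, w} = c⁻¹ • (w - z) ∧
      a • nedelecBasis t K {z, w} x =
        (a * c * bary K z x) • gradient (bary K w) x -
          (a * c * bary K w x) • gradient (bary K z) x := by
  obtain ⟨c, h0, hc, htc⟩ := exists_tangent_eq ht hzw hne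
  refine ⟨c, h0, hc, htc, ?_⟩
  have htc' : t {z, w} = (-c)⁻¹ • (z - w) := by
    rw [htc, inv_neg, neg_smul, ← smul_neg, neg_sub]
  rw [nedelecBasis_pair t K hne, hK.inner_tangent_gradient hz hw hne htc,
    hK.inner_tangent_gradient hw hz hne.symm htc', smul_add, smul_smul, smul_smul, sub_eq_add_neg,
    ← neg_smul]
  congr 2
  · field_simp
  · field_simp

/-- Each Whitney term is at most `|c| ‖∇λ‖ ≤ 2κr · 1/(2r) = κ`. -/
theorem norm_nedelecBasis_le (hK : IsTetrahedron K) {t : Finset E3 → E3} {z w : E3} (hz : z ∈ K)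
    (hw : w ∈ K) (hne : z ≠ w) (ht : ‖t {z, w}‖ = 1) (hzw : ∃ c : ℝ, w - z = c • t {z, w})
    {c : E3} {r κ : ℝ} (hr : 0 < r) (hball : Metric.closedBall c r ⊆ body K)
    (hκ : diam K ≤ κ * (2 * r)) {x : E3} (hx : x ∈ body K) :
    ‖nedelecBasis t K {z, w} x‖ ≤ 2 * κ := by
  obtain ⟨d, h0, hd, htd, hN⟩ := hK.smul_nedelecBasis_pair hz hw hne ht hzw 1 x
  have hdκ : |d| ≤ κ * (2 * r) := by
    rw [hd, ← dist_eq_norm]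
    exact (dist_le_diam (mem_body hw) (mem_body hz)).trans hκ
  have key : ∀ z ∈ K, ∀ w ∈ K, ‖(1 * d * bary K z x) • gradient (bary K w) x‖ ≤ κ := by
    intro z hz w hw
    have h1 := norm_gradient_affine_le hr
      (fun y hy => ⟨hK.mem_body_iff.mp (hball hy) w hw, hK.bary_le_one (hball hy) hw⟩) x
    have h2 := hK.mem_body_iff.mp hx z hz
    have h3 := hK.bary_le_one hx hz
    rw [norm_smul, one_mul, norm_mul, Real.norm_eq_abs, Real.norm_eq_abs, abs_of_nonneg h2]
    have hκ0 : 0 ≤ κ := by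
      by_contra! h
      have := mul_neg_of_neg_of_pos h (by linarith : 0 < 2 * r)
      linarith [abs_nonneg d]
    calc |d| * bary K z x * ‖gradient (bary K w) x‖
        ≤ κ * (2 * r) * 1 * ‖gradient (bary K w) x‖ := by gcongr
      _ = κ * (‖gradient (bary K w) x‖ * (2 * r)) := by ring
      _ ≤ κ * 1 := by gcongr
      _ = κ := mul_one κ
  rw [one_smul] at hN
  rw [hN]
  calc _ ≤ _ := norm_sub_le _ _
    _ ≤ κ + κ := add_le_add (key z hz w hw) (key w hw z hz)
    _ = 2 * κ := by ring

/-- The affine function `y ↦ ⟪c, y - z⟫` equals its barycentric interpolant; compare gradients. -/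
theorem sum_inner_smul_gradient (hK : IsTetrahedron K) (c z x : E3) :
    ∑ w ∈ K, ⟪c, w - z⟫ • gradient (bary K w) x = c := by
  refine ext_inner_right ℝ fun v => ?_
  rw [sum_inner]
  have h : ∀ y : E3, ∑ w ∈ K, ⟪c, w - z⟫ * bary K w y = ⟪c, y - z⟫ := fun y => by
    conv_rhs => rw [← hK.sum_bary_smul y, ← one_smul ℝ z, ← hK.sum_bary y, Finset.sum_smul,
      ← Finset.sum_sub_distrib, inner_sum]
    refine Finset.sum_congr rfl fun w _ => ?_
    rw [← smul_sub, real_inner_smul_right, mul_comm]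
  have h2 : ∀ w ∈ K, ⟪⟪c, w - z⟫ • gradient (bary K w) x, v⟫ =
      ⟪c, w - z⟫ * bary K w (z + v) - ⟪c, w - z⟫ * bary K w z := fun w _ => by
    rw [real_inner_smul_left, ← mul_sub, ← inner_gradient_affine_sub _ x, add_sub_cancel_left]
  rw [Finset.sum_congr rfl h2, Finset.sum_sub_distrib, h, h]
  simp

/-- The Nédélec basis functions reproduce constant vector fields. -/
theorem sum_inner_tangent_smul_nedelecBasis (hK : IsTetrahedron K) {t : Finset E3 → E3}
    (ht : ∀ e ∈ edgesOf K, ‖t e‖ = 1 ∧ ∀ p ∈ e, ∀ q ∈ e, ∃ c : ℝ, q - p = c • t e) (c x : E3) :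
    ∑ e ∈ edgesOf K, ⟪c, t e⟫ • nedelecBasis t K e x = c := by
  classical
  set H : E3 × E3 → E3 := fun p =>
    bary K p.1 x • (⟪c, p.2 - p.1⟫ • gradient (bary K p.2) x) with hH
  have h1 : ∀ e ∈ edgesOf K, ⟪c, t e⟫ • nedelecBasis t K e x = ∑ p ∈ e.offDiag, H p := by
    intro e he
    obtain ⟨heK, hcard⟩ := Finset.mem_powersetCard.mp he
    obtain ⟨z, w, hne, hezw⟩ := Finset.card_eq_two.mp hcard
    have hze : z ∈ e := by rw [hezw]; simp
    have hwe : w ∈ e := by rw [hezw]; simp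
    have hoff : e.offDiag = {(z, w), (w, z)} := by
      ext ⟨a, b⟩
      simp only [hezw, Finset.mem_offDiag, Finset.mem_insert, Finset.mem_singleton, Prod.mk.injEq]
      grind
    have hpair : ((z, w) : E3 × E3) ≠ (w, z) := fun h => hne (Prod.mk.inj h).1
    rw [hoff, Finset.sum_pair hpair]
    obtain ⟨ht1, ht2⟩ := ht e he
    have ht3 := ht2 z hze w hwe
    have hez : e = {z, w} := by rw [hezw]
    rw [hez] at ht1 ht3 ⊢
    obtain ⟨d, hd0, -, htd, hN⟩ := hK.smul_nedelecBasis_pair (heK hze) (heK hwe) hne ht1 ht3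
      ⟪c, t {z, w}⟫ x
    have hd : ⟪c, t {z, w}⟫ * d = ⟪c, w - z⟫ := by
      rw [htd, real_inner_smul_right]
      field_simp
    rw [hN, hd, sub_eq_add_neg, ← neg_smul]
    simp only [hH, smul_smul]
    congr 2
    · ring
    · rw [← neg_sub w z, inner_neg_right]; ring
  -- Every ordered pair of distinct vertices belongs to exactly one edge, so the edge sum is a
  -- double sum over vertices. The diagonal terms vanish, summing over the second vertex gives `λ_z
  -- c`, and the `λ_z` add up to `1`.
  rw [Finset.sum_congr rfl h1, Finset.sum_comm' (t' := K.offDiag) (s' := fun p => {{p.1, p.2}})]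
  · simp only [Finset.sum_singleton]
    have h2 : ∑ p ∈ K.offDiag, H p = ∑ p ∈ K ×ˢ K, H p := by
      refine Finset.sum_subset (fun p hp => ?_) fun p hp hp' => ?_
      · rw [Finset.mem_offDiag] at hp
        exact Finset.mem_product.mpr ⟨hp.1, hp.2.1⟩
      · rw [Finset.mem_product] at hp
        have : p.1 = p.2 := by
          by_contra h
          exact hp' (Finset.mem_offDiag.mpr ⟨hp.1, hp.2, h⟩)
        simp [hH, this]
    rw [h2, Finset.sum_product]
    simp only [hH]
    simp_rw [← Finset.smul_sum, hK.sum_inner_smul_gradient, ← Finset.sum_smul]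
    rw [hK.sum_bary, one_smul]
  · rintro e ⟨a, b⟩
    simp only [edgesOf, Finset.mem_powersetCard, Finset.mem_offDiag, Finset.mem_singleton]
    constructor
    · rintro ⟨⟨heK, hcard⟩, ha, hb, hab⟩
      refine ⟨(Finset.eq_of_subset_of_card_le ?_ ?_).symm, heK ha, heK hb, hab⟩
      · intro y hy
        rcases Finset.mem_insert.mp hy with rfl | hy
        · exact ha
        · exact Finset.mem_singleton.mp hy ▸ hb
      · rw [hcard, Finset.card_pair hab]
    · rintro ⟨rfl, ha, hb, hab⟩
      refine ⟨⟨?_, Finset.card_pair hab⟩, by simp, by simp, hab⟩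
      intro y hy
      rcases Finset.mem_insert.mp hy with rfl | hy
      · exact ha
      · exact Finset.mem_singleton.mp hy ▸ hb

end IsTetrahedron

/-! ### Elements, faces and edges of a triangulation -/

namespace Triangulation

variable {Ω : Set E3} {T : Triangulation Ω}

theorem mem_tets {K : Finset E3} : K ∈ T.tets ↔ K ∈ T.faces ∧ K.card = 4 := by
  simp [tets]

theorem mem_triangles {F : Finset E3} : F ∈ T.triangles ↔ F ∈ T.faces ∧ F.card = 3 := by
  simp [triangles]

theorem mem_edges {e : Finset E3} : e ∈ T.edges ↔ e ∈ T.faces ∧ e.card = 2 := by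
  simp [edges]

theorem mem_patch {e K : Finset E3} : K ∈ T.patch e ↔ K ∈ T.tets ∧ e ⊆ K := by
  simp [patch]

theorem mem_maxPatch {μ : Finset E3 → ℝ} {e K : Finset E3} :
    K ∈ T.maxPatch μ e ↔ K ∈ T.patch e ∧ ∀ K' ∈ T.patch e, (μ K')⁻¹ ≤ (μ K)⁻¹ := by
  simp [maxPatch]

theorem mem_minPatch {μ : Finset E3 → ℝ} {e K : Finset E3} :
    K ∈ T.minPatch μ e ↔ K ∈ T.patch e ∧ ∀ K' ∈ T.patch e, (μ K)⁻¹ ≤ (μ K')⁻¹ := by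
  simp [minPatch]

theorem mem_interiorFaces {e F : Finset E3} : F ∈ T.interiorFaces e ↔ F ∈ T.triangles ∧
    ∃ K ∈ T.patch e, ∃ K' ∈ T.patch e, K ≠ K' ∧ F ⊆ K ∧ F ⊆ K' := by
  simp [interiorFaces]

theorem mem_minFaces {μ : Finset E3 → ℝ} {e F : Finset E3} : F ∈ T.minFaces μ e ↔
    F ∈ T.interiorFaces e ∧ ∃ K ∈ T.minPatch μ e, F ⊆ K := by
  simp [minFaces]

theorem isTetrahedron {K : Finset E3} (hK : K ∈ T.tets) : IsTetrahedron K :=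
  ⟨(mem_tets.mp hK).2, T.indep (mem_tets.mp hK).1⟩

theorem mem_edges_of_mem_edgesOf {K e : Finset E3} (hK : K ∈ T.tets) (he : e ∈ edgesOf K) :
    e ∈ T.edges := by
  obtain ⟨heK, hc⟩ := Finset.mem_powersetCard.mp he
  exact mem_edges.mpr ⟨T.down_closed (mem_tets.mp hK).1 heK (Finset.card_pos.mp (by lia)), hc⟩

theorem mem_triangles_of_subset {K F : Finset E3} (hK : K ∈ T.tets) (hF : F ⊆ K)
    (hc : F.card = 3) : F ∈ T.triangles :=
  mem_triangles.mpr ⟨T.down_closed (mem_tets.mp hK).1 hF (Finset.card_pos.mp (by lia)), hc⟩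

theorem body_inter_subset {s t : Finset E3} (hs : s ∈ T.faces)
    (ht : t ∈ T.faces) : body s ∩ body t ⊆ body (s ∩ t) := by
  have := T.inter_subset_convexHull hs ht
  simpa only [body, Finset.coe_inter] using this

theorem card_inter_lt {K K' : Finset E3} (hK : K ∈ T.tets) (hK' : K' ∈ T.tets)
    (hne : K ≠ K') : (K ∩ K').card < 4 := by
  by_contra! h
  have h1 := (mem_tets.mp hK).2
  have h2 := (mem_tets.mp hK').2
  have h3 : K ∩ K' = K :=
    Finset.eq_of_subset_of_card_le Finset.inter_subset_left (h1.trans_le h)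
  have h4 : K ∩ K' = K' :=
    Finset.eq_of_subset_of_card_le Finset.inter_subset_right (h2.trans_le h)
  exact hne (h3.symm.trans h4)

theorem inter_eq_of_subset {K K' F : Finset E3} (hK : K ∈ T.tets)
    (hK' : K' ∈ T.tets) (hne : K ≠ K') (hF : F.card = 3) (hFK : F ⊆ K) (hFK' : F ⊆ K') :
    K ∩ K' = F := by
  have := card_inter_lt hK hK' hne
  exact (Finset.eq_of_subset_of_card_le (Finset.subset_inter hFK hFK')
    ((Nat.lt_succ_iff.mp this).trans_eq hF.symm)).symm

theorem exists_tet_of_mem_closure {x : E3} (hx : x ∈ closure Ω) : ∃ K ∈ T.tets, x ∈ body K := by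
  rw [← T.space_eq, Geometry.SimplicialComplex.mem_space_iff] at hx
  obtain ⟨s, hs, hxs⟩ := hx
  obtain ⟨K, hK, hsK, hc⟩ := T.exists_tet s hs
  exact ⟨K, mem_tets.mpr ⟨hK, hc⟩, body_mono hsK hxs⟩

theorem body_subset_closure {s : Finset E3} (hs : s ∈ T.faces) : body s ⊆ closure Ω := by
  rw [← T.space_eq]
  exact Geometry.SimplicialComplex.convexHull_subset_space hs

/-- If a relative interior point of a face of `K` lies in `K'`, then `K'` has that face. -/
theorem subset_of_mem_body {s K K' : Finset E3} (hs : s ∈ T.faces) (hK : K ∈ T.tets)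
    (hK' : K' ∈ T.tets) (hsK : s ⊆ K) {p : E3} (hp : p ∈ body s)
    (hpos : ∀ w ∈ s, 0 < bary K w p) (hpK' : p ∈ body K') : s ⊆ K' := by
  classical
  intro w hw
  by_contra hwK'
  have h1 := body_inter_subset hs (mem_tets.mp hK').1 ⟨hp, hpK'⟩
  have h2 := ((isTetrahedron hK).mem_body_face_iff
    (Finset.inter_subset_left.trans hsK)).mp h1
  exact (hpos w hw).ne' (h2.2 w (hsK hw) (fun h => hwK' (Finset.mem_inter.mp h).2))

theorem exists_relInterior_point {s K : Finset E3} (hK : K ∈ T.tets) (hsK : s ⊆ K)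
    (hs : s.Nonempty) : ∃ p ∈ body s, ∀ w ∈ K, w ∈ s → 0 < bary K w p := by
  have hT := isTetrahedron hK
  have hc : 0 < (s.card : ℝ) := by exact_mod_cast hs.card_pos
  have hsum : ∑ w ∈ s, (s.card : ℝ)⁻¹ = 1 := by
    rw [Finset.sum_const, nsmul_eq_mul, mul_inv_cancel₀ hc.ne']
  -- The witness is the centroid of `s`.
  refine ⟨∑ w ∈ s, (s.card : ℝ)⁻¹ • w, (convex_convexHull ℝ _).sum_mem (fun z hz => by positivity)
    hsum fun z hz => subset_convexHull ℝ _ hz, fun w hw hws => ?_⟩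
  have h1 : bary K w (∑ w ∈ s, (s.card : ℝ)⁻¹ • w) = ∑ y ∈ s, (s.card : ℝ)⁻¹ * bary K w y := by
    have h2 := Finset.map_affineCombination s (fun y : E3 => y) (fun _ => (s.card : ℝ)⁻¹) hsum
      (bary K w)
    rw [Finset.affineCombination_eq_linear_combination _ _ _ hsum,
      Finset.affineCombination_eq_linear_combination _ _ _ hsum] at h2
    simpa using h2
  rw [h1, Finset.sum_eq_single w]
  · rw [hT.bary_self hw]; positivity
  · intro y hy hyw
    rw [hT.bary_ne hw (hsK hy) hyw, mul_zero]
  · exact fun h => absurd hws h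

/-- The signed distance to the plane of a face in terms of the barycentric coordinate at the
opposite vertex. -/
theorem inner_normal_sub {K F : Finset E3} (hK : K ∈ T.tets) {n : E3}
    (hn : ∀ p ∈ F, ∀ q ∈ F, ⟪n, q - p⟫ = 0) {z p : E3} (hz : z ∈ K) (hp : p ∈ F)
    (hzF : ∀ w ∈ K, w ≠ z → w ∈ F) (x : E3) : ⟪n, x - p⟫ = bary K z x * ⟪n, z - p⟫ := by
  have hT := isTetrahedron hK
  conv_lhs => rw [← hT.sum_bary_smul x, ← one_smul ℝ p, ← hT.sum_bary x, Finset.sum_smul,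
    ← Finset.sum_sub_distrib, inner_sum]
  rw [Finset.sum_eq_single z]
  · rw [← smul_sub, real_inner_smul_right]
  · intro w hw hwz
    rw [← smul_sub, real_inner_smul_right, hn p hp w (hzF w hw hwz), mul_zero]
  · exact fun h => absurd hz h

/-- Otherwise, by `inner_normal_sub`, `n` would be orthogonal to every vector, itself included. -/
theorem inner_normal_ne_zero {K F : Finset E3} (hK : K ∈ T.tets) {n : E3} (hn1 : ‖n‖ = 1)
    (hn : ∀ p ∈ F, ∀ q ∈ F, ⟪n, q - p⟫ = 0) {z p : E3} (hz : z ∈ K) (hp : p ∈ F)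
    (hzF : ∀ w ∈ K, w ≠ z → w ∈ F) : ⟪n, z - p⟫ ≠ 0 := by
  intro h
  have h1 := inner_normal_sub hK hn hz hp hzF (p + n)
  rw [h, mul_zero, add_sub_cancel_left, real_inner_self_eq_norm_sq, hn1] at h1
  norm_num at h1

theorem exists_opposite {K F : Finset E3} (hK : K.card = 4) (hF : F.card = 3) (hFK : F ⊆ K) :
    ∃ z ∈ K, z ∉ F ∧ ∀ w ∈ K, w ≠ z → w ∈ F := by
  classical
  obtain ⟨z, hz⟩ := Finset.card_eq_one.mp
    (by rw [Finset.card_sdiff_of_subset hFK]; lia : (K \ F).card = 1)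
  have h : ∀ w, w ∈ K \ F ↔ w = z := fun w => by rw [hz, Finset.mem_singleton]
  simp only [Finset.mem_sdiff] at h
  exact ⟨z, ((h z).mpr rfl).1, ((h z).mpr rfl).2, fun w hw hwz => by
    by_contra hwF
    exact hwz ((h w).mp ⟨hw, hwF⟩)⟩

/-- Two different elements that share a face lie on different sides of it. -/
theorem inner_normal_mul_neg {K K' F : Finset E3} (hK : K ∈ T.tets) (hK' : K' ∈ T.tets)
    (hne : K ≠ K') (hF : F.card = 3) (hFK : F ⊆ K) (hFK' : F ⊆ K') {n : E3} (hn1 : ‖n‖ = 1)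
    (hn : ∀ p ∈ F, ∀ q ∈ F, ⟪n, q - p⟫ = 0) {z z' p : E3} (hz : z ∈ K) (hzF : z ∉ F)
    (hz' : z' ∈ K') (hz'F : z' ∉ F) (hp : p ∈ F) : ⟪n, z - p⟫ * ⟪n, z' - p⟫ < 0 := by
  classical
  have hopp : ∀ {K z}, K ∈ T.tets → F ⊆ K → z ∈ K → z ∉ F → ∀ w ∈ K, w ≠ z → w ∈ F := by
    intro K z hK hFK hz hzF w hw hwz
    obtain ⟨y, hy, -, h⟩ := exists_opposite (mem_tets.mp hK).2 hF hFK
    have : z = y := by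
      by_contra h'
      exact hzF (h z hz h')
    exact h w hw (this ▸ hwz)
  have ho := hopp hK hFK hz hzF
  have ho' := hopp hK' hFK' hz' hz'F
  have h0 := inner_normal_ne_zero hK hn1 hn hz hp ho
  have h0' := inner_normal_ne_zero hK' hn1 hn hz' hp ho'
  by_contra! h
  -- If `z` and `z'` were on the same side, a short step from a relative interior point `q` of `F`
  -- towards `z` would enter both `K` and `K'` off `F`, contradicting conformity.
  have hpos : 0 < bary K' z' z := by
    have h1 := inner_normal_sub hK' hn hz' hp ho' z
    rw [h1, mul_assoc] at h
    rw [h1] at h0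
    have h2 : 0 < ⟪n, z' - p⟫ * ⟪n, z' - p⟫ := mul_self_pos.mpr h0'
    rcases (left_ne_zero_of_mul h0).lt_or_gt with h3 | h3
    · exact absurd h (not_le.mpr (mul_neg_of_neg_of_pos h3 h2))
    · exact h3
  obtain ⟨q, hq, hqpos⟩ := exists_relInterior_point hK' hFK' (Finset.card_pos.mp (by lia))
  have hTK := isTetrahedron hK
  have hTK' := isTetrahedron hK'
  have hqz : bary K' z' q = 0 := ((hTK'.mem_body_face_iff hFK').mp hq).2 z' hz' hz'F
  have hline : ∀ (w : E3) (ε : ℝ),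
      bary K' w (AffineMap.lineMap q z ε) = (1 - ε) * bary K' w q + ε * bary K' w z := by
    intro w ε
    rw [AffineMap.apply_lineMap, AffineMap.lineMap_apply_ring]
  have hev : ∀ᶠ ε in nhdsWithin (0 : ℝ) (Ioi 0), ∀ w ∈ F,
      0 < bary K' w (AffineMap.lineMap q z ε) := by
    refine (Finset.eventually_all F).mpr fun w hw => ?_
    have hc : Continuous fun ε : ℝ => bary K' w (AffineMap.lineMap q z ε) := by
      simp only [hline]
      fun_prop
    refine nhdsWithin_le_nhds (hc.continuousAt.eventually_const_lt ?_)
    simp only [AffineMap.lineMap_apply_zero]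
    exact hqpos w (hFK' hw) hw
  obtain ⟨ε, hε, hε1, hε0⟩ :=
    (hev.and (Filter.Eventually.and (nhdsWithin_le_nhds (gt_mem_nhds zero_lt_one))
      self_mem_nhdsWithin)).exists
  have hε0 : 0 < ε := hε0
  have hxz : 0 < bary K' z' (AffineMap.lineMap q z ε) := by
    rw [hline, hqz, mul_zero, zero_add]
    exact mul_pos hε0 hpos
  have hxK' : AffineMap.lineMap q z ε ∈ body K' := by
    refine hTK'.mem_body_iff.mpr fun w hw => ?_
    by_cases hwz : w = z'
    · exact hwz ▸ hxz.le
    · exact (hε w (ho' w hw hwz)).le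
  have hxK : AffineMap.lineMap q z ε ∈ body K :=
    (convex_convexHull ℝ _).segment_subset (body_mono hFK hq) (mem_body hz)
      (by rw [segment_eq_image_lineMap]; exact ⟨ε, ⟨hε0.le, hε1.le⟩, rfl⟩)
  have hxF := body_inter_subset (mem_tets.mp hK).1 (mem_tets.mp hK').1 ⟨hxK, hxK'⟩
  rw [inter_eq_of_subset hK hK' hne hF hFK hFK'] at hxF
  exact hxz.ne' (((hTK'.mem_body_face_iff hFK').mp hxF).2 z' hz' hz'F)

/-- There are finitely many elements and they are closed: close to `q` one meets only elements
containing `q`. -/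
theorem eventually_forall_tets_mem (q : E3) :
    ∀ᶠ y in nhds q, ∀ K ∈ T.tets, y ∈ body K → q ∈ body K := by
  refine (Finset.eventually_all T.tets).mpr fun K _ => ?_
  by_cases hq : q ∈ body K
  · exact Filter.Eventually.of_forall fun _ _ => hq
  · filter_upwards [(isCompact_body K).isClosed.isOpen_compl.mem_nhds hq] with y hy h
    exact absurd h hy

/-- Boundary faces do not meet the domain. -/
theorem IsBoundaryFace.notMem (hΩ : IsOpen Ω) {F : Finset E3} (hF : T.IsBoundaryFace F) {p : E3}
    (hp : p ∈ body F) : p ∉ Ω := by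
  intro hpΩ
  obtain ⟨hFT, K, ⟨hK, hFK⟩, huniq⟩ := hF
  have hT := isTetrahedron hK
  have hFc := (mem_triangles.mp hFT).2
  obtain ⟨z, hz, hzF, -⟩ := exists_opposite hT.1 hFc hFK
  obtain ⟨q₀, hq₀, hq₀pos⟩ := exists_relInterior_point hK hFK (Finset.card_pos.mp (by lia))
  have hlim : ∀ a b : E3, Filter.Tendsto (fun ε : ℝ => AffineMap.lineMap a b ε)
      (nhdsWithin 0 (Ioi 0)) (nhds a) := fun a b => by
    have h := ((AffineMap.lineMap_continuous (R := ℝ) (p := a) (q := b)).tendsto 0)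
    rw [AffineMap.lineMap_apply_zero] at h
    exact h.mono_left nhdsWithin_le_nhds
  -- Move `p` to a relative interior point `q` of `F` without leaving the open set `Ω`.
  obtain ⟨ε, hεΩ, hε1, hε0⟩ := ((hlim p q₀).eventually (hΩ.mem_nhds hpΩ)
    |>.and (Filter.Eventually.and (nhdsWithin_le_nhds (gt_mem_nhds zero_lt_one))
      self_mem_nhdsWithin)).exists
  have hε0 : 0 < ε := hε0
  set q : E3 := AffineMap.lineMap p q₀ ε with hq
  have hqF : q ∈ body F := (convex_convexHull ℝ _).segment_subset hp hq₀
    (by rw [segment_eq_image_lineMap]; exact ⟨ε, ⟨hε0.le, hε1.le⟩, rfl⟩)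
  have hqpos : ∀ w ∈ F, 0 < bary K w q := fun w hw => by
    rw [hq, AffineMap.apply_lineMap, AffineMap.lineMap_apply_ring]
    have h1 := ((hT.mem_body_face_iff hFK).mp hp).1 w (hFK hw)
    have h2 := mul_pos hε0 (hq₀pos w (hFK hw) hw)
    have h3 := mul_nonneg (sub_nonneg.mpr hε1.le) h1
    linarith
  have hqz : bary K z q = 0 := ((hT.mem_body_face_iff hFK).mp hqF).2 z hz hzF
  -- The point `2q - z` is the reflection of `z` in `q`, so this steps across `F` away from `K`. The
  -- element found there contains `q`, hence has the face `F` and must be `K`, although the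
  -- coordinate at `z` is now negative.
  obtain ⟨s, ⟨hsΩ, hsK⟩, hs0⟩ := (((hlim q ((2 : ℝ) • q - z)).eventually
    ((hΩ.eventually_mem hεΩ).and (eventually_forall_tets_mem (T := T) q))).and
      self_mem_nhdsWithin).exists
  have hs0 : 0 < s := hs0
  obtain ⟨K', hK', hyK'⟩ := exists_tet_of_mem_closure (T := T) (subset_closure hsΩ)
  have hFK' := subset_of_mem_body (mem_triangles.mp hFT).1 hK hK' hFK hqF hqpos (hsK K' hK' hyK')
  have hKK' := huniq K' ⟨hK', hFK'⟩
  subst hKK'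
  have h1 := hT.mem_body_iff.mp hyK' z hz
  have h2 : AffineMap.lineMap q ((2 : ℝ) • q - z) s = AffineMap.lineMap q z (-s) := by
    rw [AffineMap.lineMap_apply_module', AffineMap.lineMap_apply_module']
    module
  rw [h2, AffineMap.apply_lineMap, AffineMap.lineMap_apply_ring, hqz, hT.bary_self hz] at h1
  linarith

end Triangulation

/-! ### Local connectedness at the Lipschitz boundary -/

/-- Near a boundary point, the domain lies in a connected part of itself. -/
theorem IsLipschitzDomain.exists_isPreconnected {Ω : Set E3} (hΩ : IsLipschitzDomain Ω) {p : E3}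
    (hp : p ∈ frontier Ω) {R : ℝ} (hR : 0 < R) :
    ∃ ρ > 0, ∃ U : Set E3, IsPreconnected U ∧ Ω ∩ Metric.ball p ρ ⊆ U ∧
      U ⊆ Ω ∩ Metric.ball p R := by
  obtain ⟨-, -, -, hloc⟩ := hΩ
  obtain ⟨ν, g, L, r, hν, hg, hinv, hr, hΩg⟩ := hloc p hp
  set s₀ := min r R / 2 with hs₀
  have hs₀pos : 0 < s₀ := by positivity
  have hrR : s₀ + s₀ = min r R := by rw [hs₀]; ring
  -- Passing from `c` to a point of its `ρ`-ball raises the height by at most `ρ` and lowers the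
  -- graph by at most `Lρ`. As `s₀ > (L + 1)ρ`, the ball stays below the graph.
  set ρ := s₀ / (L + 2) with hρ
  have hρpos : 0 < ρ := by positivity
  have hρs : ρ * (L + 2) = s₀ := div_mul_cancel₀ _ (by positivity)
  have hρL : 0 ≤ ρ * L := by positivity
  have hpg : ⟪ν, p⟫ ≤ g p := by
    have hcl : p ∈ closure (Ω ∩ Metric.ball p r) := by
      rw [mem_closure_iff_nhds]
      intro t ht
      obtain ⟨x, hx⟩ := mem_closure_iff_nhds.mp (frontier_subset_closure hp) _
        (Filter.inter_mem ht (Metric.ball_mem_nhds p hr))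
      exact ⟨x, hx.1.1, hx.2, hx.1.2⟩
    refine closure_minimal (s := Ω ∩ Metric.ball p r) (t := {y | ⟪ν, y⟫ ≤ g y}) ?_ ?_ hcl
    · exact fun y hy => ((hΩg y hy.2).mp hy.1).le
    · exact isClosed_le (by fun_prop) hg.continuous
  set c := p - s₀ • ν with hc
  have hgc : g c = g p := by rw [hc, sub_eq_add_neg, ← neg_smul, hinv]
  have hνs : ⟪ν, s₀ • ν⟫ = s₀ := by
    rw [real_inner_smul_right, real_inner_self_eq_norm_sq, hν]; ring
  have hballR : Metric.ball c ρ ⊆ Ω ∩ Metric.ball p R := by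
    intro z hz
    rw [mem_ball_iff_norm] at hz
    have hzp : ‖z - p‖ < min r R := by
      have : z - p = (z - c) - s₀ • ν := by rw [hc]; abel
      rw [this]
      have h1 := norm_sub_le (z - c) (s₀ • ν)
      rw [norm_smul, hν, mul_one, Real.norm_eq_abs, abs_of_pos hs₀pos] at h1
      linarith
    refine ⟨(hΩg z (mem_ball_iff_norm.mpr (hzp.trans_le (min_le_left _ _)))).mpr ?_,
      mem_ball_iff_norm.mpr (hzp.trans_le (min_le_right _ _))⟩
    have h1 : ⟪ν, z⟫ = ⟪ν, p⟫ - s₀ + ⟪ν, z - c⟫ := by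
      rw [inner_sub_right, hc, inner_sub_right, hνs]; ring
    have h2 : ⟪ν, z - c⟫ ≤ ‖z - c‖ := by
      simpa [hν] using real_inner_le_norm ν (z - c)
    have h3 := hg.dist_le_mul z c
    rw [Real.dist_eq, dist_eq_norm, hgc] at h3
    have h4 := neg_abs_le (g z - g p)
    have h5 : (L : ℝ) * ‖z - c‖ ≤ L * ρ := mul_le_mul_of_nonneg_left hz.le L.2
    nlinarith
  -- Every point of `Ω` near `p` descends along `-ν` by `s₀`, staying below the graph, into one
  -- common ball.
  refine ⟨ρ, hρpos, ⋃ y ∈ Ω ∩ Metric.ball p ρ, (segment ℝ y (y - s₀ • ν) ∪ Metric.ball c ρ),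
    ?_, ?_, ?_⟩
  · rw [← sUnion_image]
    refine isPreconnected_sUnion c _ ?_ ?_
    · rintro _ ⟨y, -, rfl⟩
      exact .inr (Metric.mem_ball_self hρpos)
    · rintro _ ⟨y, hy, rfl⟩
      refine IsPreconnected.union (y - s₀ • ν) (right_mem_segment ℝ _ _) ?_
        (convex_segment _ _).isPreconnected (convex_ball _ _).isPreconnected
      have h1 : y - s₀ • ν - c = y - p := by rw [hc]; abel
      rw [mem_ball_iff_norm, h1]
      exact mem_ball_iff_norm.mp hy.2
  · intro y hy
    exact mem_biUnion hy (.inl (left_mem_segment ℝ _ _))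
  · refine iUnion₂_subset fun y hy => union_subset ?_ hballR
    rintro x hx
    rw [segment_eq_image'] at hx
    obtain ⟨s, ⟨hs0, hs1⟩, rfl⟩ := hx
    have hyp := mem_ball_iff_norm.mp hy.2
    have hx : y + s • (y - s₀ • ν - y) = y + (-(s * s₀)) • ν := by module
    simp only [hx]
    have hss : s * s₀ ≤ s₀ := mul_le_of_le_one_left hs₀pos.le hs1
    have hxp : ‖y + (-(s * s₀)) • ν - p‖ < min r R := by
      have h1 := norm_add_le (y - p) ((-(s * s₀)) • ν)
      rw [norm_smul, hν, mul_one, Real.norm_eq_abs, abs_neg,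
        abs_of_nonneg (mul_nonneg hs0 hs₀pos.le)] at h1
      have h2 : y + (-(s * s₀)) • ν - p = y - p + (-(s * s₀)) • ν := by abel
      rw [h2]
      linarith
    refine ⟨(hΩg _ (mem_ball_iff_norm.mpr (hxp.trans_le (min_le_left _ _)))).mpr ?_,
      mem_ball_iff_norm.mpr (hxp.trans_le (min_le_right _ _))⟩
    rw [hinv, inner_add_right, real_inner_smul_right, real_inner_self_eq_norm_sq, hν]
    have hyr : y ∈ Metric.ball p r := by
      rw [mem_ball_iff_norm]
      have := min_le_left r R
      linarith
    have := (hΩg y hyr).mp hy.1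
    nlinarith [mul_nonneg hs0 hs₀pos.le]

namespace Triangulation

variable {Ω : Set E3} {T : Triangulation Ω}

theorem body_subset_closure_interior {K : Finset E3} (hK : K ∈ T.tets) :
    body K ⊆ closure (interior (body K)) := by
  obtain ⟨p, -, hp⟩ := exists_relInterior_point hK subset_rfl
    (Finset.card_pos.mp (by rw [(mem_tets.mp hK).2]; norm_num))
  have hne : (interior (body K)).Nonempty :=
    ⟨p, (isTetrahedron hK).mem_interior_body_iff.mpr fun z hz => hp z hz hz⟩
  have hcl := (convex_convexHull ℝ (K : Set E3)).closure_interior_eq_closure_of_nonempty_interior hne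
  exact subset_closure.trans hcl.ge

/-- In a Lipschitz domain, the patch of a boundary edge is connected through faces. -/
theorem patch_connected (hΩ : IsLipschitzDomain Ω) {e : Finset E3} (he : T.IsBoundaryEdge e)
    {C : Finset E3 → Prop}
    (hC : ∀ L ∈ T.patch e, ∀ L' ∈ T.patch e, T.ShareFace L L' → C L → C L')
    {K K' : Finset E3} (hK : K ∈ T.patch e) (hK' : K' ∈ T.patch e) (hCK : C K) : C K' := by
  classical
  by_contra hCK'
  obtain ⟨D, hD⟩ : ∃ D : Finset E3 → Prop, ∀ L, D L ↔ ¬ C L := ⟨fun L => ¬ C L, fun _ => .rfl⟩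
  obtain ⟨heT, F, hF, heF⟩ := he
  obtain ⟨hKT, heK⟩ := mem_patch.mp hK
  have hec := (mem_edges.mp heT).2
  obtain ⟨p, hpe, hppos⟩ := exists_relInterior_point hKT heK (Finset.card_pos.mp (by lia))
  have heΩ : ∀ x ∈ body e, x ∉ Ω := fun x hx => hF.notMem hΩ.1 (body_mono heF hx)
  have hpfr : p ∈ frontier Ω := by
    rw [hΩ.1.frontier_eq]
    exact ⟨body_subset_closure (mem_edges.mp heT).1 hpe, heΩ p hpe⟩
  obtain ⟨R, hR, hRp⟩ := Metric.eventually_nhds_iff_ball.mp (eventually_forall_tets_mem (T := T) p)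
  obtain ⟨ρ, hρ, U, hU, hΩU, hUΩ⟩ := hΩ.exists_isPreconnected hpfr hR
  have hclosed : ∀ P : Finset E3 → Prop, IsClosed (⋃ L ∈ (T.patch e).filter P, body L) := fun P =>
    isClosed_biUnion_finset fun L _ => (isCompact_body L).isClosed
  -- Near `p` there are interior points of `L`; they lie in the closure of `Ω`, so some point of `Ω`
  -- is close enough to remain in `L`.
  have hmeet : ∀ (P : Finset E3 → Prop), ∀ L ∈ T.patch e, P L →
      (U ∩ ⋃ L ∈ (T.patch e).filter P, body L).Nonempty := by
    intro P L hL hPL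
    obtain ⟨hLT, heL⟩ := mem_patch.mp hL
    have h1 := mem_closure_iff.mp (body_subset_closure_interior hLT (body_mono heL hpe))
      _ Metric.isOpen_ball (Metric.mem_ball_self hρ)
    obtain ⟨x, hxρ, hxL⟩ := h1
    obtain ⟨y, ⟨hyρ, hyL⟩, hyΩ⟩ := mem_closure_iff.mp
      (body_subset_closure (mem_tets.mp hLT).1 (interior_subset hxL)) _
      (Metric.isOpen_ball.inter isOpen_interior) ⟨hxρ, hxL⟩
    exact ⟨y, hΩU ⟨hyΩ, hyρ⟩, mem_biUnion (Finset.mem_filter.mpr ⟨hL, hPL⟩) (interior_subset hyL)⟩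
  -- The elements with `C` and those without it give two closed sets that cover `U` and both meet
  -- it, so they share a point of `U`.
  obtain ⟨x, hxU, hx1, hx2⟩ := isPreconnected_closed_iff.mp hU _ _ (hclosed C)
    (hclosed D) (fun x hx => by
      obtain ⟨L, hL, hxL⟩ := exists_tet_of_mem_closure (T := T) (subset_closure (hUΩ hx).1)
      have hpL := hRp x (hUΩ hx).2 L hL hxL
      have heL := subset_of_mem_body (mem_edges.mp heT).1 hKT hL heK hpe
        (fun w hw => hppos w (heK hw) hw) hpL
      have hLp : L ∈ T.patch e := mem_patch.mpr ⟨hL, heL⟩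
      by_cases hCL : C L
      · exact .inl (mem_biUnion (Finset.mem_filter.mpr ⟨hLp, hCL⟩) hxL)
      · exact .inr (mem_biUnion (Finset.mem_filter.mpr ⟨hLp, (hD L).mpr hCL⟩) hxL))
    (hmeet C K hK hCK) (hmeet D K' hK' ((hD K').mpr hCK'))
  obtain ⟨L, hL, hxL⟩ := mem_iUnion₂.mp hx1
  obtain ⟨L', hL', hxL'⟩ := mem_iUnion₂.mp hx2
  obtain ⟨hL, hCL⟩ := Finset.mem_filter.mp hL
  obtain ⟨hL', hDL'⟩ := Finset.mem_filter.mp hL'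
  have hCL' := (hD L').mp hDL'
  have hne : L ≠ L' := fun h => hCL' (h ▸ hCL)
  obtain ⟨hLT, heL⟩ := mem_patch.mp hL
  obtain ⟨hLT', heL'⟩ := mem_patch.mp hL'
  have hxi := body_inter_subset (mem_tets.mp hLT).1 (mem_tets.mp hLT').1 ⟨hxL, hxL'⟩
  have hsub : e ⊆ L ∩ L' := Finset.subset_inter heL heL'
  have hlt := card_inter_lt hLT hLT' hne
  have hge := Finset.card_le_card hsub
  rw [hec] at hge
  -- Two distinct elements of the patch meet either in `e` alone, which lies outside `Ω`, or in a
  -- face, across which `C` propagates.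
  rcases hge.eq_or_lt with h2 | h3
  · rw [← Finset.eq_of_subset_of_card_le hsub (by rw [hec, ← h2])] at hxi
    exact heΩ x hxi (hUΩ hxU).1
  · refine hCL' (hC L hL L' hL' ⟨hne, L ∩ L', ?_, Finset.inter_subset_left,
      Finset.inter_subset_right⟩ hCL)
    exact mem_triangles_of_subset hLT Finset.inter_subset_left
      (le_antisymm (Nat.lt_succ_iff.mp hlt) h3)

/-! ### The two elements at an interior face -/

section Normal

variable {n : Finset E3 → E3} {F K K' : Finset E3}

/-- Of three elements on one face, two would lie on the same side of its plane. -/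
theorem eq_or_eq_of_subset (hn : T.IsUnitNormal n) (hF : F ∈ T.triangles) (hK : K ∈ T.tets)
    (hK' : K' ∈ T.tets) (hne : K ≠ K') (hFK : F ⊆ K) (hFK' : F ⊆ K') {L : Finset E3}
    (hL : L ∈ T.tets) (hFL : F ⊆ L) : L = K ∨ L = K' := by
  by_contra! h
  obtain ⟨hn1, hn0⟩ := hn F hF
  have hFc := (mem_triangles.mp hF).2
  obtain ⟨p, hp⟩ := Finset.card_pos.mp (by lia : 0 < F.card)
  obtain ⟨z₁, h₁, h₁F, -⟩ := exists_opposite (mem_tets.mp hK).2 hFc hFK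
  obtain ⟨z₂, h₂, h₂F, -⟩ := exists_opposite (mem_tets.mp hK').2 hFc hFK'
  obtain ⟨z₃, h₃, h₃F, -⟩ := exists_opposite (mem_tets.mp hL).2 hFc hFL
  have h12 := inner_normal_mul_neg hK hK' hne hFc hFK hFK' hn1 hn0 h₁ h₁F h₂ h₂F hp
  have h13 := inner_normal_mul_neg hL hK h.1 hFc hFL hFK hn1 hn0 h₃ h₃F h₁ h₁F hp
  have h23 := inner_normal_mul_neg hL hK' h.2 hFc hFL hFK' hn1 hn0 h₃ h₃F h₂ h₂F hp
  rcases mul_neg_iff.mp h12 with h | h <;> rcases mul_neg_iff.mp h13 with h' | h' <;>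
    rcases mul_neg_iff.mp h23 with h'' | h'' <;> linarith [h.1, h.2, h'.1, h'.2, h''.1, h''.2]

theorem inner_normal_eq (hn : T.IsUnitNormal n) (hF : F ∈ T.triangles) {p q : E3} (hp : p ∈ F)
    (hq : q ∈ F) (z : E3) : ⟪n F, z - q⟫ = ⟪n F, z - p⟫ := by
  have h := (hn F hF).2 q hq p hp
  have h2 : z - q = (z - p) + (p - q) := by abel
  rw [h2, inner_add_right, h, add_zero]

/-- The two elements on `F` are the only candidates and the sign condition excludes one of them, so
both `epsilon` choices are determined. -/
theorem elem_eq_of_inner_neg (hn : T.IsUnitNormal n) (hF : F ∈ T.triangles) (hK : K ∈ T.tets)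
    (hK' : K' ∈ T.tets) (hne : K ≠ K') (hFK : F ⊆ K) (hFK' : F ⊆ K') {z p : E3} (hz : z ∈ K)
    (hzF : z ∉ F) (hp : p ∈ F) (hneg : ⟪n F, z - p⟫ < 0) :
    T.elemMinus n F = K ∧ T.elemPlus n F = K' := by
  obtain ⟨hn1, hn0⟩ := hn F hF
  have hFc := (mem_triangles.mp hF).2
  have hminus : K ∈ T.tets ∧ F ⊆ K ∧ ∀ z ∈ K, z ∉ F → ∀ p ∈ F, ⟪n F, z - p⟫ < 0 := by
    refine ⟨hK, hFK, fun y hy hyF q hq => ?_⟩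
    have hyz : y = z := by
      obtain ⟨x, -, -, hx⟩ := exists_opposite (mem_tets.mp hK).2 hFc hFK
      by_contra hyz
      by_cases hyx : y = x
      · exact hzF (hx z hz (fun h => hyz (hyx.trans h.symm)))
      · exact hyF (hx y hy hyx)
    rw [hyz, inner_normal_eq hn hF hp hq]
    exact hneg
  have hplus : K' ∈ T.tets ∧ F ⊆ K' ∧ ∀ z ∈ K', z ∉ F → ∀ p ∈ F, 0 < ⟪n F, z - p⟫ := by
    refine ⟨hK', hFK', fun y hy hyF q hq => ?_⟩
    have := inner_normal_mul_neg hK hK' hne hFc hFK hFK' hn1 hn0 hz hzF hy hyF hq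
    rw [inner_normal_eq hn hF hp hq z] at this
    exact pos_of_mul_neg_right this hneg.le
  have h1 := Classical.epsilon_spec
    (p := fun K => K ∈ T.tets ∧ F ⊆ K ∧ ∀ z ∈ K, z ∉ F → ∀ p ∈ F, ⟪n F, z - p⟫ < 0) ⟨K, hminus⟩
  have h2 := Classical.epsilon_spec
    (p := fun K => K ∈ T.tets ∧ F ⊆ K ∧ ∀ z ∈ K, z ∉ F → ∀ p ∈ F, 0 < ⟪n F, z - p⟫) ⟨K', hplus⟩
  change T.elemMinus n F ∈ T.tets ∧ F ⊆ T.elemMinus n F ∧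
    ∀ z ∈ T.elemMinus n F, z ∉ F → ∀ p ∈ F, ⟪n F, z - p⟫ < 0 at h1
  change T.elemPlus n F ∈ T.tets ∧ F ⊆ T.elemPlus n F ∧
    ∀ z ∈ T.elemPlus n F, z ∉ F → ∀ p ∈ F, 0 < ⟪n F, z - p⟫ at h2
  obtain ⟨z', hz', hz'F, -⟩ := exists_opposite (mem_tets.mp hK').2 hFc hFK'
  have hpos := hplus.2.2 z' hz' hz'F p hp
  constructor
  · rcases eq_or_eq_of_subset hn hF hK hK' hne hFK hFK' h1.1 h1.2.1 with h | h
    · exact h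
    · rw [h] at h1
      exact absurd (h1.2.2 z' hz' hz'F p hp) hpos.not_gt
  · rcases eq_or_eq_of_subset hn hF hK hK' hne hFK hFK' h2.1 h2.2.1 with h | h
    · rw [h] at h2
      exact absurd (h2.2.2 z hz hzF p hp) hneg.not_gt
    · exact h

theorem elemMinus_elemPlus (hn : T.IsUnitNormal n) (hF : F ∈ T.triangles) (hK : K ∈ T.tets)
    (hK' : K' ∈ T.tets) (hne : K ≠ K') (hFK : F ⊆ K) (hFK' : F ⊆ K') :
    (T.elemMinus n F = K ∧ T.elemPlus n F = K') ∨
      (T.elemMinus n F = K' ∧ T.elemPlus n F = K) := by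
  obtain ⟨hn1, hn0⟩ := hn F hF
  have hFc := (mem_triangles.mp hF).2
  obtain ⟨p, hp⟩ := Finset.card_pos.mp (by lia : 0 < F.card)
  obtain ⟨z, hz, hzF, -⟩ := exists_opposite (mem_tets.mp hK).2 hFc hFK
  obtain ⟨z', hz', hz'F, -⟩ := exists_opposite (mem_tets.mp hK').2 hFc hFK'
  have h := inner_normal_mul_neg hK hK' hne hFc hFK hFK' hn1 hn0 hz hzF hz' hz'F hp
  rcases mul_neg_iff.mp h with h | h
  · exact .inr (elem_eq_of_inner_neg hn hF hK' hK hne.symm hFK' hFK hz' hz'F hp h.2)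
  · exact .inl (elem_eq_of_inner_neg hn hF hK hK' hne hFK hFK' hz hzF hp h.1)

end Normal

/-! ### Flags around an edge -/

variable (T) in
/-- An element of the patch of `e` together with one of its two faces that contain `e`. -/
def Flag (e : Finset E3) : Type :=
  {x : Finset E3 × Finset E3 // x.1 ∈ T.patch e ∧ x.2 ∈ T.triangles ∧ e ⊆ x.2 ∧ x.2 ⊆ x.1}

instance (e : Finset E3) : Finite (T.Flag e) := by
  refine Set.Finite.to_subtype (Set.Finite.subset (T.patch e ×ˢ T.triangles).finite_toSet ?_)
  rintro x ⟨h1, h2, -⟩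
  exact Finset.mem_coe.mpr (Finset.mem_product.mpr ⟨h1, h2⟩)

open Classical in
variable (T) in
/-- The element on the other side of the face `F` of `L`, or `L` itself if there is none. -/
noncomputable def neighbor (F L : Finset E3) : Finset E3 :=
  if h : ∃ L' ∈ T.tets, F ⊆ L' ∧ L' ≠ L then h.choose else L

theorem neighbor_spec {F L : Finset E3} (hL : L ∈ T.tets) (hF : F ⊆ L) :
    T.neighbor F L ∈ T.tets ∧ F ⊆ T.neighbor F L := by
  unfold neighbor
  split_ifs with h
  · exact ⟨h.choose_spec.1, h.choose_spec.2.1⟩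
  · exact ⟨hL, hF⟩

theorem neighbor_eq {n : Finset E3 → E3} (hn : T.IsUnitNormal n) {F L L' : Finset E3}
    (hFT : F ∈ T.triangles) (hL : L ∈ T.tets) (hF : F ⊆ L) (hL' : L' ∈ T.tets) (hF' : F ⊆ L')
    (hne : L' ≠ L) : T.neighbor F L = L' := by
  have h : ∃ L' ∈ T.tets, F ⊆ L' ∧ L' ≠ L := ⟨L', hL', hF', hne⟩
  have h1 : T.neighbor F L = h.choose := dif_pos h
  rcases eq_or_eq_of_subset hn hFT hL hL' hne.symm hF hF' h.choose_spec.1 h.choose_spec.2.1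
    with h2 | h2
  · exact absurd h2 h.choose_spec.2.2
  · rw [h1, h2]

theorem neighbor_eq_self {F L : Finset E3} (h : ¬ ∃ L' ∈ T.tets, F ⊆ L' ∧ L' ≠ L) :
    T.neighbor F L = L := dif_neg h

theorem neighbor_neighbor {n : Finset E3 → E3} (hn : T.IsUnitNormal n) {F L : Finset E3}
    (hFT : F ∈ T.triangles) (hL : L ∈ T.tets) (hF : F ⊆ L) :
    T.neighbor F (T.neighbor F L) = L := by
  by_cases h : ∃ L' ∈ T.tets, F ⊆ L' ∧ L' ≠ L
  · obtain ⟨L', hL', hF', hne⟩ := h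
    rw [neighbor_eq hn hFT hL hF hL' hF' hne, neighbor_eq hn hFT hL' hF' hL hF hne.symm]
  · rw [neighbor_eq_self h, neighbor_eq_self h]

theorem oppositeFace_spec {e F L : Finset E3} (hec : e.card = 2) (hL : L ∈ T.tets)
    (hFc : F.card = 3) (heF : e ⊆ F) (hFL : F ⊆ L) :
    e ∪ (L \ F) ⊆ L ∧ (e ∪ (L \ F)).card = 3 := by
  refine ⟨Finset.union_subset (heF.trans hFL) Finset.sdiff_subset, ?_⟩
  rw [Finset.card_union_of_disjoint (Finset.disjoint_sdiff.mono_left heF),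
    Finset.card_sdiff_of_subset hFL, hec, hFc, (mem_tets.mp hL).2]

namespace Flag

variable {e : Finset E3}

/-- The flag on the other side of the face. -/
noncomputable def cross (x : T.Flag e) : T.Flag e :=
  ⟨(T.neighbor x.1.2 x.1.1, x.1.2), mem_patch.mpr
    ⟨(neighbor_spec (mem_patch.mp x.2.1).1 x.2.2.2.2).1,
      x.2.2.2.1.trans (neighbor_spec (mem_patch.mp x.2.1).1 x.2.2.2.2).2⟩,
    x.2.2.1, x.2.2.2.1, (neighbor_spec (mem_patch.mp x.2.1).1 x.2.2.2.2).2⟩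

/-- The flag with the other face of the element. -/
noncomputable def turn (he : e ∈ T.edges) (x : T.Flag e) : T.Flag e :=
  have h := oppositeFace_spec (mem_edges.mp he).2 (mem_patch.mp x.2.1).1
    (mem_triangles.mp x.2.2.1).2 x.2.2.2.1 x.2.2.2.2
  ⟨(x.1.1, e ∪ (x.1.1 \ x.1.2)), x.2.1,
    mem_triangles_of_subset (mem_patch.mp x.2.1).1 h.1 h.2, Finset.subset_union_left, h.1⟩

theorem cross_involutive {n : Finset E3 → E3} (hn : T.IsUnitNormal n) :
    Function.Involutive (cross : T.Flag e → T.Flag e) := fun x =>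
  Subtype.ext (Prod.ext (neighbor_neighbor hn x.2.2.1 (mem_patch.mp x.2.1).1 x.2.2.2.2) rfl)

/-- An element has two vertices off `e`, and each face through `e` contains exactly one of them. -/
theorem eq_or_eq_turn (he : e ∈ T.edges) (x y : T.Flag e) (h : x.1.1 = y.1.1) :
    y = x ∨ y = turn he x := by
  obtain ⟨⟨L, F⟩, hL, hF, heF, hFL⟩ := x
  obtain ⟨⟨L', F'⟩, hL', hF', heF', hFL'⟩ := y
  simp only at h hL hF heF hFL hL' hF' heF' hFL'
  subst h
  by_cases hFF : F' = F
  · exact .inl (Subtype.ext (Prod.ext rfl hFF))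
  · refine .inr (Subtype.ext (Prod.ext rfl ?_))
    change F' = e ∪ (L \ F)
    have hFc := (mem_triangles.mp hF).2
    have hFc' := (mem_triangles.mp hF').2
    have hopp := oppositeFace_spec (mem_edges.mp he).2 (mem_patch.mp hL).1 hFc heF hFL
    refine (Finset.eq_of_subset_of_card_le (Finset.union_subset heF' fun w hw => ?_)
      (hFc'.trans hopp.2.symm).le).symm
    obtain ⟨z, hz, hzF, hz2⟩ := exists_opposite (mem_tets.mp (mem_patch.mp hL).1).2 hFc hFL
    obtain ⟨hwL, hwF⟩ := Finset.mem_sdiff.mp hw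
    by_contra hwF'
    refine hFF (Finset.eq_of_subset_of_card_le (fun y hy => hz2 y (hFL' hy) ?_)
      (hFc.trans hFc'.symm).le)
    rintro rfl
    exact hwF (hz2 w hwL fun h => hwF' (h ▸ hy))

theorem turn_ne (he : e ∈ T.edges) (x : T.Flag e) : turn he x ≠ x := by
  intro h
  have h2 : e ∪ (x.1.1 \ x.1.2) = x.1.2 := congrArg (fun y : T.Flag e => y.1.2) h
  obtain ⟨z, hz, hzF, -⟩ := exists_opposite (mem_tets.mp (mem_patch.mp x.2.1).1).2
    (mem_triangles.mp x.2.2.1).2 x.2.2.2.2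
  exact hzF (h2 ▸ Finset.mem_union_right _ (Finset.mem_sdiff.mpr ⟨hz, hzF⟩))

theorem turn_involutive (he : e ∈ T.edges) :
    Function.Involutive (turn he : T.Flag e → T.Flag e) := fun x => by
  rcases eq_or_eq_turn he (turn he x) x rfl with h | h
  · exact absurd h.symm (turn_ne he x)
  · exact h.symm

theorem exists_flag (he : e ∈ T.edges) {L : Finset E3} (hL : L ∈ T.patch e) :
    ∃ x : T.Flag e, x.1.1 = L := by
  obtain ⟨hLT, heL⟩ := mem_patch.mp hL
  obtain ⟨F, heF, hFL, hF⟩ := Finset.exists_subsuperset_card_eq heL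
    (by rw [(mem_edges.mp he).2]; norm_num : e.card ≤ 3)
    (by rw [(mem_tets.mp hLT).2]; norm_num)
  exact ⟨⟨(L, F), hL, mem_triangles_of_subset hLT hFL hF, heF, hFL⟩, rfl⟩

theorem flagAdj_of_shareFace {n : Finset E3 → E3} (hn : T.IsUnitNormal n) {L L' : Finset E3}
    (hL : L ∈ T.patch e) (hL' : L' ∈ T.patch e) (h : T.ShareFace L L') :
    FlagAdj (cross : T.Flag e → T.Flag e) (fun x => x.1.1) L L' := by
  obtain ⟨hne, F, hF, hFL, hFL'⟩ := h
  obtain ⟨hLT, heL⟩ := mem_patch.mp hL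
  obtain ⟨hLT', heL'⟩ := mem_patch.mp hL'
  have heF : e ⊆ F := by
    rw [← inter_eq_of_subset hLT hLT' hne (mem_triangles.mp hF).2 hFL hFL']
    exact Finset.subset_inter heL heL'
  exact ⟨⟨(L, F), hL, hF, heF, hFL⟩, rfl, neighbor_eq hn hF hLT hFL hLT' hFL' hne.symm⟩

end Flag

/-! ### Sublevel sets of `μ⁻¹` in a patch -/

variable (T) in
/-- Two elements of the patch share a face and have `μ⁻¹ ≤ a`. -/
def SublevelShare (μ : Finset E3 → ℝ) (e : Finset E3) (a : ℝ) (L L' : Finset E3) : Prop :=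
  L ∈ T.patch e ∧ L' ∈ T.patch e ∧ T.ShareFace L L' ∧ (μ L)⁻¹ ≤ a ∧ (μ L')⁻¹ ≤ a

theorem SublevelShare.symm {μ : Finset E3 → ℝ} {e : Finset E3} {a : ℝ} {L L' : Finset E3}
    (h : T.SublevelShare μ e a L L') : T.SublevelShare μ e a L' L := by
  obtain ⟨h1, h2, ⟨hne, F, hF, h3, h4⟩, h5, h6⟩ := h
  exact ⟨h2, h1, ⟨hne.symm, F, hF, h4, h3⟩, h6, h5⟩

/-- Crossing a boundary face stays in the same element; such idle steps are dropped. -/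
theorem reflTransGen_sublevelShare {μ : Finset E3 → ℝ} {e : Finset E3} {a : ℝ} {L L' : Finset E3}
    (h : Relation.ReflTransGen
      (SublevelAdj (Flag.cross : T.Flag e → T.Flag e) (fun x => x.1.1) (fun L => (μ L)⁻¹) a) L L') :
    Relation.ReflTransGen (T.SublevelShare μ e a) L L' := by
  induction h with
  | refl => exact .refl
  | @tail L₁ L₂ _ h ih =>
    obtain ⟨⟨x, hx1, hx2⟩, h1, h2⟩ := h
    simp only at hx1 hx2
    by_cases hne : L₁ = L₂
    · exact hne ▸ ih
    · exact ih.tail ⟨hx1 ▸ x.2.1, hx2 ▸ x.cross.2.1,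
        ⟨hne, x.1.2, x.2.2.1, hx1 ▸ x.2.2.2.2, hx2 ▸ x.cross.2.2.2.2⟩, h1, h2⟩

/-- Under quasi-monotonicity, every element `K` of a patch is joined to every element with smallest
`μ⁻¹` through elements on which `μ⁻¹` is at most its value on `K`. -/
theorem QuasiMonotone.sublevel_connected {μ : Finset E3 → ℝ} (hμ : T.QuasiMonotone μ)
    (hΩ : IsLipschitzDomain Ω) {n : Finset E3 → E3} (hn : T.IsUnitNormal n) {e : Finset E3}
    (he : e ∈ T.edges) {K K₁ : Finset E3} (hK : K ∈ T.patch e) (hK₁ : K₁ ∈ T.minPatch μ e) :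
    Relation.ReflTransGen (T.SublevelShare μ e (μ K)⁻¹) K K₁ := by
  obtain ⟨hK₁p, hK₁min⟩ := mem_minPatch.mp hK₁
  obtain ⟨hint, hbdry⟩ := hμ e he
  have hmono : ∀ {A B}, T.MonotonePath μ e A B → Relation.ReflTransGen (fun A B =>
      FlagAdj (Flag.cross : T.Flag e → T.Flag e) (fun x => x.1.1) A B ∧ (μ A)⁻¹ ≤ (μ B)⁻¹) A B :=
    fun h => Relation.ReflTransGen.mono
      (fun A B h => ⟨Flag.flagAdj_of_shareFace hn h.1 h.2.1 h.2.2.1, h.2.2.2⟩) _ _ h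
  by_cases hKmax : K ∈ T.maxPatch μ e
  -- For a maximal `K` the bound holds on the whole patch. At a boundary edge with constant `μ`,
  -- quasi-monotonicity provides no path at all, so connectedness must come from the geometry.
  · have hall := (mem_maxPatch.mp hKmax).2
    by_cases hb : T.IsBoundaryEdge e
    · exact patch_connected hΩ hb (C := Relation.ReflTransGen (T.SublevelShare μ e (μ K)⁻¹) K)
        (fun L hL L' hL' h hKL => hKL.tail ⟨hL, hL', h, hall L hL, hall L' hL'⟩) hK hK₁p .refl
    · have : Std.Symm (T.SublevelShare μ e (μ K)⁻¹) := ⟨fun _ _ h => h.symm⟩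
      exact Std.Symm.symm _ _ <| Relation.ReflTransGen.mono
        (fun A B h => ⟨h.1, h.2.1, h.2.2.1, hall A h.1, hall B h.2.1⟩) _ _ (hint hb K₁ hK₁p K hKmax)
  · have hK₁max : K₁ ∉ T.maxPatch μ e := fun h => hKmax <| mem_maxPatch.mpr
      ⟨hK, fun L hL => ((mem_maxPatch.mp h).2 L hL).trans (hK₁min K hK)⟩
    by_cases hb : T.IsBoundaryEdge e
    · obtain ⟨h1, F, hF, heF, M, hM, hFM⟩ := hbdry hb
      have hMp := (mem_maxPatch.mp hM).1
      -- The walk starts at `turn y`, so that its mirror image `y`, the flag of the boundary face,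
      -- is fixed by `cross`.
      set y : T.Flag e := ⟨(M, F), hMp, hF.1, heF, hFM⟩ with hy
      have hcy : y.cross = y := by
        refine Subtype.ext (Prod.ext (neighbor_eq_self ?_) rfl)
        rintro ⟨L', hL', hF', hne⟩
        obtain ⟨N, -, hN⟩ := hF.2
        exact hne ((hN L' ⟨hL', hF'⟩).trans (hN M ⟨(mem_patch.mp hMp).1, hFM⟩).symm)
      have hty : Flag.turn he (Flag.turn he y) = y := Flag.turn_involutive he y
      exact reflTransGen_sublevelShare <| sublevel_connected_of_boundary
        (v := fun L => (μ L)⁻¹) (x₀ := Flag.turn he y)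
        (Flag.turn_involutive he) (Flag.cross_involutive hn) (fun _ => rfl)
        (Flag.eq_or_eq_turn he) (by rw [hty, hcy]) (hmono (h1 K hK hKmax M hM))
        (hmono (h1 K₁ hK₁p hK₁max M hM)) (hK₁min K hK)
    · obtain ⟨M, hM, hMmax⟩ := (T.patch e).exists_max_image (fun L => (μ L)⁻¹) ⟨K, hK⟩
      obtain ⟨x₀, rfl⟩ := Flag.exists_flag he hM
      obtain ⟨x, rfl⟩ := Flag.exists_flag he hK
      obtain ⟨y, rfl⟩ := Flag.exists_flag he hK₁p
      refine reflTransGen_sublevelShare <| sublevel_connected_of_interior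
        (v := fun L => (μ L)⁻¹) (π := fun x : T.Flag e => x.1.1)
        (Flag.turn_involutive he) (Flag.cross_involutive hn) (fun _ => rfl)
        (Flag.eq_or_eq_turn he) (Flag.turn_ne he) ?_
        (fun z => hmono (hint hb _ z.2.1 _ (mem_maxPatch.mpr ⟨hM, hMmax⟩))) (hK₁min _ hK)
      -- A flag fixed by `cross` sits on a boundary face, which would make `e` a boundary edge.
      intro z hz
      refine hb ⟨he, z.1.2, ⟨z.2.2.1, z.1.1, ⟨(mem_patch.mp z.2.1).1, z.2.2.2.2⟩, ?_⟩, z.2.2.2.1⟩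
      rintro L ⟨hL, hFL⟩
      by_contra hne
      have h1 := neighbor_eq hn z.2.2.1 (mem_patch.mp z.2.1).1 z.2.2.2.2 hL hFL hne
      exact hne (h1.symm.trans (congrArg (fun w : T.Flag e => w.1.1) hz))

/-- The variation of a quantity between joined elements is at most the sum of its jumps, each of
them counted once: the intervals spanned by the jumps cover the one between the end values. -/
theorem abs_sub_le_sum_of_reflTransGen {V ι : Type*} {r : V → V → Prop} (s : V → ℝ) (p q : ι → ℝ)
    (S : Finset ι) (hr : ∀ a b, r a b → ∃ i ∈ S, uIcc (s a) (s b) ⊆ uIcc (p i) (q i)) {a b : V}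
    (h : Relation.ReflTransGen r a b) : |s a - s b| ≤ ∑ i ∈ S, |p i - q i| := by
  have hcover : s a = s b ∨ uIcc (s a) (s b) ⊆ ⋃ i ∈ S, uIcc (p i) (q i) := by
    induction h with
    | refl => exact .inl rfl
    | tail _ hbc ih =>
      obtain ⟨i, hi, hsub⟩ := hr _ _ hbc
      have h1 := hsub.trans (subset_biUnion_of_mem (u := fun i => uIcc (p i) (q i))
        (Finset.mem_coe.mpr hi))
      rcases ih with ih | ih
      · rw [ih]; exact .inr h1
      · exact .inr (uIcc_subset_uIcc_union_uIcc.trans (union_subset ih h1))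
  rcases hcover with h | h
  · rw [h, sub_self, abs_zero]
    exact Finset.sum_nonneg fun i _ => abs_nonneg _
  -- Comparing Lebesgue measures of the covered interval and the cover makes faces that a path
  -- crosses repeatedly harmless.
  · have h1 := (measure_mono (μ := volume) h).trans (measure_biUnion_finset_le S _)
    simp only [Real.volume_interval] at h1
    rw [← ENNReal.ofReal_sum_of_nonneg fun i _ => abs_nonneg _,
      ENNReal.ofReal_le_ofReal_iff (Finset.sum_nonneg fun i _ => abs_nonneg _)] at h1
    rw [abs_sub_comm]
    exact h1.trans_eq (Finset.sum_congr rfl fun i _ => abs_sub_comm _ _)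

end Triangulation

/-! ### Areas of faces -/

/-- An isometric parametrization of the plane through `c` with unit normal `n`. -/
theorem exists_isometry_plane {n : E3} (hn : ‖n‖ = 1) (c : E3) :
    ∃ f : EuclideanSpace ℝ (Fin 2) → E3, Isometry f ∧ f 0 = c ∧
      range f = {x | ⟪n, x - c⟫ = 0} := by
  have hn0 : n ≠ 0 := fun h => by simp [h] at hn
  have : Fact (Module.finrank ℝ E3 = 2 + 1) := ⟨by simp⟩
  let b := OrthonormalBasis.fromOrthogonalSpanSingleton (𝕜 := ℝ) 2 hn0
  refine ⟨fun y => c + (b.repr.symm y : E3), ?_, by simp, ?_⟩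
  · refine Isometry.of_dist_eq fun y z => ?_
    rw [dist_add_left, ← b.repr.symm.dist_map y z]
    rfl
  · ext x
    simp only [mem_range, mem_ofPred_eq]
    constructor
    · rintro ⟨y, rfl⟩
      rw [add_sub_cancel_left]
      exact Submodule.mem_orthogonal_singleton_iff_inner_right.mp (b.repr.symm y).2
    · intro h
      exact ⟨b.repr ⟨x - c, Submodule.mem_orthogonal_singleton_iff_inner_right.mpr h⟩, by simp⟩

theorem euclideanHausdorffMeasure_image_closedBall {f : EuclideanSpace ℝ (Fin 2) → E3}
    (hf : Isometry f) (r : ℝ) :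
    μHE[2] (f '' Metric.closedBall 0 r) = ENNReal.ofReal r ^ 2 * ENNReal.ofReal Real.pi := by
  rw [hf.euclideanHausdorffMeasure_image, EuclideanSpace.euclideanHausdorffMeasure_eq_volume,
    EuclideanSpace.volume_closedBall_fin_two]

namespace Triangulation

variable {Ω : Set E3} {T : Triangulation Ω}

/-- The shadow of a ball in `K`, seen from the vertex opposite to the face `F`, contains a disc of
the same radius. -/
theorem exists_disc_subset_body {K F : Finset E3} (hK : K ∈ T.tets) (hF : F.card = 3)
    (hFK : F ⊆ K) {n : E3} (hn : ∀ p ∈ F, ∀ q ∈ F, ⟪n, q - p⟫ = 0) (hn1 : ‖n‖ = 1) {x : E3} {r : ℝ}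
    (hr : 0 < r) (hball : Metric.closedBall x r ⊆ body K) :
    ∃ y : E3, ∀ v, ⟪n, v⟫ = 0 → ‖v‖ ≤ r → y + v ∈ body F := by
  have hT := isTetrahedron hK
  obtain ⟨z, hz, hzF, hzopp⟩ := exists_opposite hT.1 hF hFK
  obtain ⟨p, hp⟩ := Finset.card_pos.mp (by lia : 0 < F.card)
  have hpz : p ≠ z := fun h => hzF (h ▸ hp)
  have hxint : x ∈ interior (body K) :=
    mem_interior_iff_mem_nhds.mpr (Filter.mem_of_superset (Metric.closedBall_mem_nhds x hr) hball)
  have hpos := hT.mem_interior_body_iff.mp hxint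
  have hlt : bary K z x < 1 := by
    rw [← hT.sum_bary x]
    exact Finset.single_lt_sum (f := fun z => bary K z x) hpz hz (hFK hp) (hpos p (hFK hp))
      fun w hw _ => (hpos w hw).le
  have hs : 0 < 1 - bary K z x := by linarith
  -- The homothety with centre `z` and ratio `s ≥ 1` carries the plane through `x` parallel to `F`
  -- onto the plane of `F`. It does not shrink the disc of radius `r` about `x`.
  set s : ℝ := (1 - bary K z x)⁻¹ with hs_def
  have hs0 : 0 < s := inv_pos.mpr hs
  have hs1 : s * (1 - bary K z x) = 1 := inv_mul_cancel₀ hs.ne'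
  refine ⟨AffineMap.lineMap z x s, fun v hv hvr => ?_⟩
  have heq : AffineMap.lineMap z x s + v = AffineMap.lineMap z (x + s⁻¹ • v) s := by
    rw [AffineMap.lineMap_apply_module', AffineMap.lineMap_apply_module', add_sub_right_comm,
      smul_add, smul_smul, mul_inv_cancel₀ hs0.ne', one_smul]
    abel
  have hmem : x + s⁻¹ • v ∈ body K := by
    refine hball ?_
    rw [mem_closedBall_iff_norm, add_sub_cancel_left, norm_smul, Real.norm_eq_abs,
      abs_of_pos (inv_pos.mpr hs0), hs_def, inv_inv]
    have h1 := (hpos z hz).le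
    nlinarith [norm_nonneg v]
  have hbz : bary K z (x + s⁻¹ • v) = bary K z x := by
    have h1 := inner_normal_sub hK hn hz hp hzopp x
    have h2 := inner_normal_sub hK hn hz hp hzopp (x + s⁻¹ • v)
    rw [add_sub_right_comm, inner_add_right, real_inner_smul_right, hv, mul_zero, add_zero, h1] at h2
    exact (mul_right_cancel₀ (inner_normal_ne_zero hK hn1 hn hz hp hzopp) h2).symm
  have hz0 : bary K z (AffineMap.lineMap z (x + s⁻¹ • v) s) = 0 := by
    rw [AffineMap.apply_lineMap, AffineMap.lineMap_apply_ring, hT.bary_self hz, hbz]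
    linarith
  rw [heq, hT.mem_body_face_iff hFK]
  refine ⟨fun w hw => ?_, fun w hw hwF => ?_⟩
  · by_cases hwz : w = z
    · rw [hwz, hz0]
    · rw [AffineMap.apply_lineMap, AffineMap.lineMap_apply_ring, hT.bary_ne hw hz (Ne.symm hwz),
        mul_zero, zero_add]
      exact mul_nonneg hs0.le (hT.mem_body_iff.mp hmem w hw)
  · have hwz : w = z := by
      by_contra h
      exact hwF (hzopp w hw h)
    rw [hwz, hz0]

/-- Finiteness makes the real-valued `area` monotone. A face lies in a disc of radius `diam F` in
its plane. -/
theorem measure_body_lt_top {n : Finset E3 → E3} (hn : T.IsUnitNormal n) {F : Finset E3}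
    (hF : F ∈ T.triangles) : μHE[2] (body F) < ⊤ := by
  obtain ⟨hn1, hn0⟩ := hn F hF
  have hFc := (mem_triangles.mp hF).2
  obtain ⟨K, hKf, hFK, hKc⟩ := T.exists_tet F (mem_triangles.mp hF).1
  have hK := mem_tets.mpr ⟨hKf, hKc⟩
  obtain ⟨z, hz, hzF, hzopp⟩ := exists_opposite hKc hFc hFK
  obtain ⟨p, hp⟩ := Finset.card_pos.mp (by lia : 0 < F.card)
  obtain ⟨f, hf, hf0, hfr⟩ := exists_isometry_plane hn1 p
  refine (measure_mono (t := f '' Metric.closedBall 0 (diam F)) fun x hx => ?_).trans_lt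
    (by rw [euclideanHausdorffMeasure_image_closedBall hf]; exact ENNReal.mul_lt_top (by simp) (by simp))
  have hxr : x ∈ range f := by
    rw [hfr]
    change ⟪n F, x - p⟫ = 0
    rw [inner_normal_sub hK hn0 hz hp hzopp,
      (((isTetrahedron hK).mem_body_face_iff hFK).mp hx).2 z hz hzF, zero_mul]
  obtain ⟨y, rfl⟩ := hxr
  refine ⟨y, ?_, rfl⟩
  rw [Metric.mem_closedBall, ← hf.dist_eq, hf0]
  exact dist_le_diam hx (mem_body hp)

theorem pi_mul_sq_le_area {n : Finset E3 → E3} (hn : T.IsUnitNormal n) {K F : Finset E3}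
    (hK : K ∈ T.tets) (hF : F ∈ T.triangles) (hFK : F ⊆ K) {x : E3} {r : ℝ} (hr : 0 < r)
    (hball : Metric.closedBall x r ⊆ body K) : Real.pi * r ^ 2 ≤ area F := by
  obtain ⟨hn1, hn0⟩ := hn F hF
  obtain ⟨y, hy⟩ := exists_disc_subset_body hK (mem_triangles.mp hF).2 hFK hn0 hn1 hr hball
  obtain ⟨f, hf, hf0, hfr⟩ := exists_isometry_plane hn1 y
  have hsub : f '' Metric.closedBall 0 r ⊆ body F := by
    rintro _ ⟨w, hw, rfl⟩
    have h1 : f w ∈ range f := ⟨w, rfl⟩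
    rw [hfr] at h1
    have h2 := hy (f w - y) h1 (by
      rw [← dist_eq_norm, ← hf0, hf.dist_eq]
      exact hw)
    rwa [add_sub_cancel] at h2
  have h := ENNReal.toReal_mono (measure_body_lt_top hn hF).ne (measure_mono (μ := μHE[2]) hsub)
  rw [euclideanHausdorffMeasure_image_closedBall hf, ENNReal.toReal_mul, ENNReal.toReal_pow,
    ENNReal.toReal_ofReal hr.le, ENNReal.toReal_ofReal Real.pi_pos.le] at h
  rw [mul_comm]
  exact h

end Triangulation

/-! ### Edge lengths, tangential components and the constancy of the curl -/

/-- Every edge of a tetrahedron is at least as long as the diameter of any ball in it. -/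
theorem IsTetrahedron.two_mul_le_dist {K : Finset E3} (hK : IsTetrahedron K) {c : E3} {r : ℝ}
    (hr : 0 < r) (hball : Metric.closedBall c r ⊆ body K) {z w : E3} (hz : z ∈ K) (hw : w ∈ K)
    (hne : z ≠ w) : 2 * r ≤ dist w z := by
  have h1 := norm_gradient_affine_le hr
    (fun y hy => ⟨hK.mem_body_iff.mp (hball hy) w hw, hK.bary_le_one (hball hy) hw⟩) c
  have h2 := inner_gradient_affine_sub (bary K w) c w z
  rw [hK.bary_self hw, hK.bary_ne hw hz hne, sub_zero] at h2
  have h3 := real_inner_le_norm (gradient (bary K w) c) (w - z)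
  rw [h2] at h3
  rw [dist_eq_norm]
  have hpos : 0 < ‖gradient (bary K w) c‖ := by
    by_contra! h
    nlinarith [norm_nonneg (w - z), norm_nonneg (gradient (bary K w) c)]
  exact le_of_mul_le_mul_left (h1.trans h3) hpos

theorem inner_cross_cross (a b c d : E3) :
    ⟪cross a b, cross c d⟫ = ⟪a, c⟫ * ⟪b, d⟫ - ⟪a, d⟫ * ⟪b, c⟫ := by
  simp only [cross, cross_apply, PiLp.inner_apply, Fin.sum_univ_three, RCLike.inner_apply,
    conj_trivial, Matrix.cons_val]
  ring

/-- By Lagrange's identity `⟪d, t⟫ = ⟪d × n, t × n⟫`, and `t × n` is a unit vector. Thus the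
tangential jump `⟦σ × n⟧` controls the jump of `σ · t_e`. -/
theorem abs_inner_le_norm_cross {n t : E3} (hn : ‖n‖ = 1) (ht : ‖t‖ = 1) (hnt : ⟪n, t⟫ = 0)
    (d : E3) : |⟪d, t⟫| ≤ ‖cross d n‖ := by
  have hn2 : ⟪n, n⟫ = 1 := by rw [real_inner_self_eq_norm_sq, hn]; norm_num
  have ht2 : ⟪t, t⟫ = 1 := by rw [real_inner_self_eq_norm_sq, ht]; norm_num
  have h1 : ⟪d, t⟫ = ⟪cross d n, cross t n⟫ := by
    rw [inner_cross_cross, hn2, hnt]; ring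
  have h2 : ‖cross t n‖ = 1 := by
    have : ‖cross t n‖ ^ 2 = 1 := by
      rw [← real_inner_self_eq_norm_sq, inner_cross_cross, hn2, ht2, hnt]; ring
    exact (pow_eq_one_iff_of_nonneg (norm_nonneg _) two_ne_zero).mp this
  rw [h1]
  simpa [h2] using abs_real_inner_le_norm (cross d n) (cross t n)

theorem cross_sub (a b n : E3) : cross a n - cross b n = cross (a - b) n := by
  simp [cross]

/-- The curl of a local Nédélec field is constant. -/
theorem IsNedelecPoly.exists_curl_eq {p : E3 → E3} (hp : IsNedelecPoly p) :
    ∃ c : E3, ∀ x, curl p x = c := by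
  obtain ⟨a, b, h⟩ := hp
  let f : E3 →ₗ[ℝ] E3 :=
    { toFun := cross b
      map_add' := fun x y => by simp [cross]
      map_smul' := fun s x => by simp [cross] }
  have hp : p = fun x => a + LinearMap.toContinuousLinearMap f x := funext h
  have hd : ∀ x, fderiv ℝ p x = LinearMap.toContinuousLinearMap f := fun x => by
    rw [hp, fderiv_const_add, ContinuousLinearMap.fderiv]
  exact ⟨curl p 0, fun x => by simp only [curl, partialDeriv, hd]⟩

/-! ### Estimates for the weights -/

/-- The weights are balanced: with `p = √a`, `q = √b` both left sides equal `pq/(p + q)`. The common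
right side is `√2 pq/√(p² + q²)`, and `p² + q² ≤ 2(p + q)²`. -/
theorem sqrt_mul_weight_le {a b : ℝ} (ha : 0 < a) (hb : 0 < b) :
    √a * |1 - (√b)⁻¹ / ((√a)⁻¹ + (√b)⁻¹)| ≤ √(((a⁻¹ + b⁻¹) / 2)⁻¹) ∧
      √b * |(√b)⁻¹ / ((√a)⁻¹ + (√b)⁻¹)| ≤ √(((a⁻¹ + b⁻¹) / 2)⁻¹) := by
  have hp := Real.sqrt_pos.mpr ha
  have hq := Real.sqrt_pos.mpr hb
  have hap := Real.sq_sqrt ha.le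
  have hbq := Real.sq_sqrt hb.le
  set p := √a
  set q := √b
  have hle : p * q / (p + q) ≤ √(((a⁻¹ + b⁻¹) / 2)⁻¹) := by
    refine Real.le_sqrt_of_sq_le ?_
    have h : ((a⁻¹ + b⁻¹) / 2)⁻¹ = 2 * p ^ 2 * q ^ 2 / (p ^ 2 + q ^ 2) := by
      rw [← hap, ← hbq]
      field_simp
      ring
    rw [h, div_pow, div_le_div_iff₀ (by positivity) (by positivity)]
    have h1 : 0 ≤ p ^ 2 * q ^ 2 * (p ^ 2 + q ^ 2 + 4 * p * q) := by positivity
    nlinarith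
  have h1 : p * |1 - q⁻¹ / (p⁻¹ + q⁻¹)| = p * q / (p + q) := by
    have : 1 - q⁻¹ / (p⁻¹ + q⁻¹) = q / (p + q) := by
      field_simp
      ring
    rw [this, abs_of_pos (by positivity), mul_div_assoc]
  have h2 : q * |q⁻¹ / (p⁻¹ + q⁻¹)| = p * q / (p + q) := by
    rw [abs_of_pos (by positivity)]
    field_simp
    ring
  exact ⟨h1 ▸ hle, h2 ▸ hle⟩

/-- This is where sublevel paths pay off: `√μ_K ≤ √μ_F` on every face they cross, whatever the jumps
of `μ`. -/
theorem sqrt_le_sqrt_harmonicMean {a b m : ℝ} (ha : 0 < a) (hb : 0 < b) (hm : 0 < m)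
    (ham : a⁻¹ ≤ m⁻¹) (hbm : b⁻¹ ≤ m⁻¹) : √m ≤ √(((a⁻¹ + b⁻¹) / 2)⁻¹) := by
  refine Real.sqrt_le_sqrt ?_
  rw [le_inv_comm₀ hm (by positivity)]
  linarith

namespace Triangulation

variable {Ω : Set E3} {T : Triangulation Ω}

theorem mem_interiorFaces_of_subset {e L L' F : Finset E3} (hL : L ∈ T.patch e)
    (hL' : L' ∈ T.patch e) (hne : L ≠ L') (hF : F ∈ T.triangles) (hFL : F ⊆ L) (hFL' : F ⊆ L') :
    F ∈ T.interiorFaces e :=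
  mem_interiorFaces.mpr ⟨hF, L, hL, L', hL', hne, hFL, hFL'⟩

theorem subset_of_mem_interiorFaces {e F : Finset E3} (hF : F ∈ T.interiorFaces e) : e ⊆ F := by
  obtain ⟨hFT, L, hL, L', hL', hne, hFL, hFL'⟩ := mem_interiorFaces.mp hF
  obtain ⟨hLT, heL⟩ := mem_patch.mp hL
  obtain ⟨hLT', heL'⟩ := mem_patch.mp hL'
  rw [← inter_eq_of_subset hLT hLT' hne (mem_triangles.mp hFT).2 hFL hFL']
  exact Finset.subset_inter heL heL'

theorem elem_mem_patch {n : Finset E3 → E3} (hn : T.IsUnitNormal n) {e F : Finset E3}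
    (hF : F ∈ T.interiorFaces e) : T.elemMinus n F ∈ T.patch e ∧ T.elemPlus n F ∈ T.patch e := by
  obtain ⟨hFT, L, hL, L', hL', hne, hFL, hFL'⟩ := mem_interiorFaces.mp hF
  rcases elemMinus_elemPlus hn hFT (mem_patch.mp hL).1 (mem_patch.mp hL').1 hne hFL hFL'
    with ⟨h1, h2⟩ | ⟨h1, h2⟩ <;> rw [h1, h2]
  exacts [⟨hL, hL'⟩, ⟨hL', hL⟩]

theorem eq_elem_of_subset {n : Finset E3 → E3} (hn : T.IsUnitNormal n) {e F : Finset E3}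
    (hF : F ∈ T.interiorFaces e) {K : Finset E3} (hK : K ∈ T.tets) (hFK : F ⊆ K) :
    K = T.elemMinus n F ∨ K = T.elemPlus n F := by
  obtain ⟨hFT, L, hL, L', hL', hne, hFL, hFL'⟩ := mem_interiorFaces.mp hF
  have h := eq_or_eq_of_subset hn hFT (mem_patch.mp hL).1 (mem_patch.mp hL').1 hne hFL hFL' hK hFK
  rcases elemMinus_elemPlus hn hFT (mem_patch.mp hL).1 (mem_patch.mp hL').1 hne hFL hFL'
    with ⟨h1, h2⟩ | ⟨h1, h2⟩ <;> rw [h1, h2]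
  exacts [h, h.symm]

theorem area_pos {n : Finset E3 → E3} (hn : T.IsUnitNormal n) {κ : ℝ} (hκ : T.ShapeRegular κ)
    {F : Finset E3} (hF : F ∈ T.triangles) : 0 < area F := by
  obtain ⟨K, hKf, hFK, hKc⟩ := T.exists_tet F (mem_triangles.mp hF).1
  have hK := mem_tets.mpr ⟨hKf, hKc⟩
  obtain ⟨x, r, hr, hball, -⟩ := hκ K hK
  have := pi_mul_sq_le_area hn hK hF hFK hr hball
  have : 0 < Real.pi * r ^ 2 := by positivity
  linarith

theorem area_nonneg (F : Finset E3) : 0 ≤ area F := measureReal_nonneg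

theorem setIntegral_body_const (F : Finset E3) (c : ℝ) :
    ∫ _ in body F, c ∂μHE[2] = area F * c := by
  rw [setIntegral_const, smul_eq_mul]
  rfl

/-! ### Tangential components along an edge -/

section Edge

variable {μ : Finset E3 → ℝ} {n t : Finset E3 → E3} {u : Finset E3 → E3 → E3} {c : Finset E3 → E3}
  {e : Finset E3}

/-- The jump of the tangential component along `e`, weighted by `μ_F^{1/2}`. -/
noncomputable def edgeJump (T : Triangulation Ω) (μ : Finset E3 → ℝ) (n : Finset E3 → E3) (s : Finset E3 → ℝ)
    (F : Finset E3) : ℝ :=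
  √(T.muFace μ n F) * |s (T.elemMinus n F) - s (T.elemPlus n F)|

theorem edgeJump_nonneg (s : Finset E3 → ℝ) (F : Finset E3) : 0 ≤ T.edgeJump μ n s F :=
  mul_nonneg (Real.sqrt_nonneg _) (abs_nonneg _)

/-- The jump is constant on `F`, so its `L²` norm is its length times `√(area F)`. -/
theorem sqrt_area_mul_edgeJump_le (hn : T.IsUnitNormal n) (ht : T.IsUnitTangent t)
    (he : e ∈ T.edges) (hc : ∀ L ∈ T.tets, ∀ x, curl (u L) x = c L) {F : Finset E3}
    (hF : F ∈ T.interiorFaces e) :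
    √(area F) * T.edgeJump μ n (fun L => ⟪(μ L)⁻¹ • c L, t e⟫) F ≤ T.jumpNorm μ n u F := by
  obtain ⟨hm, hp⟩ := elem_mem_patch hn hF
  have heF := subset_of_mem_interiorFaces hF
  have hFT := (mem_interiorFaces.mp hF).1
  obtain ⟨hn1, hn0⟩ := hn F hFT
  obtain ⟨ht1, ht2⟩ := ht e he
  obtain ⟨z, w, hzw, rfl⟩ := Finset.card_eq_two.mp (mem_edges.mp he).2
  have hz : z ∈ ({z, w} : Finset E3) := by simp
  have hw : w ∈ ({z, w} : Finset E3) := by simp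
  obtain ⟨d, -, -, htd⟩ := exists_tangent_eq ht1 (ht2 z hz w hw) hzw
  have hnt : ⟪n F, t {z, w}⟫ = 0 := by
    rw [htd, real_inner_smul_right, hn0 z (heF hz) w (heF hw), mul_zero]
  have hjump : ∀ x, T.tangentialJump μ n u F x = cross ((μ (T.elemMinus n F))⁻¹ •
      c (T.elemMinus n F) - (μ (T.elemPlus n F))⁻¹ • c (T.elemPlus n F)) (n F) := fun x => by
    rw [tangentialJump, sigma, sigma, hc _ (mem_patch.mp hm).1, hc _ (mem_patch.mp hp).1, cross_sub]
  simp only [jumpNorm, hjump]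
  rw [setIntegral_body_const, Real.sqrt_mul (area_nonneg F), Real.sqrt_sq (norm_nonneg _),
    norm_smul, Real.norm_eq_abs, abs_of_nonneg (Real.sqrt_nonneg _), edgeJump]
  refine mul_le_mul_of_nonneg_left (mul_le_mul_of_nonneg_left ?_ (Real.sqrt_nonneg _))
    (Real.sqrt_nonneg _)
  rw [← inner_sub_left]
  exact abs_inner_le_norm_cross hn1 ht1 hnt _

/-- The sublevel path from `K` to `K₁` crosses only faces with `μ_F ≥ μ_K`; the sum of jumps is
restricted to these before the weights are exchanged. -/
theorem QuasiMonotone.sqrt_mul_abs_sub_le (hq : T.QuasiMonotone μ) (hΩ : IsLipschitzDomain Ω)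
    (hμ : ∀ K ∈ T.tets, 0 < μ K) (hn : T.IsUnitNormal n) (he : e ∈ T.edges) {K K₁ : Finset E3}
    (hK : K ∈ T.patch e) (hK₁ : K₁ ∈ T.minPatch μ e) (s : Finset E3 → ℝ) :
    √(μ K) * |s K - s K₁| ≤ ∑ F ∈ T.interiorFaces e, T.edgeJump μ n s F := by
  classical
  set good := (T.interiorFaces e).filter fun F =>
    (μ (T.elemMinus n F))⁻¹ ≤ (μ K)⁻¹ ∧ (μ (T.elemPlus n F))⁻¹ ≤ (μ K)⁻¹ with hgood
  have h := abs_sub_le_sum_of_reflTransGen (fun L => √(μ K) * s L)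
    (fun F => √(μ K) * s (T.elemMinus n F)) (fun F => √(μ K) * s (T.elemPlus n F)) good ?_
    (hq.sublevel_connected hΩ hn he hK hK₁)
  · simp only [← mul_sub, abs_mul, abs_of_nonneg (Real.sqrt_nonneg _)] at h
    refine h.trans ?_
    calc _ ≤ ∑ F ∈ good, T.edgeJump μ n s F := by
          refine Finset.sum_le_sum fun F hF => ?_
          obtain ⟨hF, h1, h2⟩ := Finset.mem_filter.mp hF
          obtain ⟨hm, hp⟩ := elem_mem_patch hn hF
          exact mul_le_mul_of_nonneg_right (sqrt_le_sqrt_harmonicMean (hμ _ (mem_patch.mp hm).1)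
            (hμ _ (mem_patch.mp hp).1) (hμ _ (mem_patch.mp hK).1) h1 h2) (abs_nonneg _)
      _ ≤ _ := Finset.sum_le_sum_of_subset_of_nonneg (Finset.filter_subset _ _)
          fun F _ _ => edgeJump_nonneg s F
  · rintro L L' ⟨hL, hL', ⟨hne, F, hF, hFL, hFL'⟩, h1, h2⟩
    have hFi := mem_interiorFaces_of_subset hL hL' hne hF hFL hFL'
    refine ⟨F, ?_, ?_⟩
    all_goals
      rcases elemMinus_elemPlus hn hF (mem_patch.mp hL).1 (mem_patch.mp hL').1 hne hFL hFL'
        with ⟨h3, h4⟩ | ⟨h3, h4⟩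
    · exact Finset.mem_filter.mpr ⟨hFi, by rw [h3, h4]; exact ⟨h1, h2⟩⟩
    · exact Finset.mem_filter.mpr ⟨hFi, by rw [h3, h4]; exact ⟨h2, h1⟩⟩
    · rw [h3, h4]
    · rw [h3, h4, uIcc_comm]

/-- The value of the weighted average on a face next to an element with smallest `μ⁻¹`. -/
theorem sqrt_mul_abs_average_sub_le (hμ : ∀ K ∈ T.tets, 0 < μ K) (hn : T.IsUnitNormal n)
    {F K K₁ : Finset E3} (hF : F ∈ T.interiorFaces e) (hK : K ∈ T.patch e)
    (hK₁ : K₁ ∈ T.minPatch μ e) (hFK₁ : F ⊆ K₁) (s : Finset E3 → ℝ) :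
    √(μ K) * |T.gammaMinus μ n F * s (T.elemMinus n F) +
      (1 - T.gammaMinus μ n F) * s (T.elemPlus n F) - s K₁| ≤ T.edgeJump μ n s F := by
  obtain ⟨hm, hp⟩ := elem_mem_patch hn hF
  obtain ⟨hK₁p, hK₁min⟩ := mem_minPatch.mp hK₁
  -- Smallest `μ⁻¹` means largest `μ`. Below, the average minus the value on `K₁` is the jump times
  -- the weight of the other element.
  have hKK₁ : √(μ K) ≤ √(μ K₁) := Real.sqrt_le_sqrt <|
    (inv_le_inv₀ (hμ _ (mem_patch.mp hK₁p).1) (hμ _ (mem_patch.mp hK).1)).mp (hK₁min K hK)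
  obtain ⟨h1, h2⟩ := sqrt_mul_weight_le (hμ _ (mem_patch.mp hm).1) (hμ _ (mem_patch.mp hp).1)
  refine (mul_le_mul_of_nonneg_right hKK₁ (abs_nonneg _)).trans ?_
  set γ := T.gammaMinus μ n F with hγ
  rcases eq_elem_of_subset hn hF (mem_patch.mp hK₁p).1 hFK₁ with h | h
  · rw [h]
    have h3 : γ * s (T.elemMinus n F) + (1 - γ) * s (T.elemPlus n F) - s (T.elemMinus n F) =
        (1 - γ) * -(s (T.elemMinus n F) - s (T.elemPlus n F)) := by ring
    rw [h3, abs_mul, abs_neg, ← mul_assoc]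
    exact mul_le_mul_of_nonneg_right h1 (abs_nonneg _)
  · rw [h]
    have h3 : γ * s (T.elemMinus n F) + (1 - γ) * s (T.elemPlus n F) - s (T.elemPlus n F) =
        γ * (s (T.elemMinus n F) - s (T.elemPlus n F)) := by ring
    rw [h3, abs_mul, ← mul_assoc]
    exact mul_le_mul_of_nonneg_right h2 (abs_nonneg _)

/-- The last step of a path from another element to a minimal one crosses a face of the latter.
Hence the total area in the recovery is not zero. -/
theorem QuasiMonotone.minFaces_nonempty (hq : T.QuasiMonotone μ) (hΩ : IsLipschitzDomain Ω)
    (hn : T.IsUnitNormal n) (he : e ∈ T.edges) (hi : (T.interiorFaces e).Nonempty) :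
    (T.minFaces μ e).Nonempty := by
  obtain ⟨F, hF⟩ := hi
  obtain ⟨-, L, hL, L', hL', hne, -, -⟩ := mem_interiorFaces.mp hF
  obtain ⟨K₁, hK₁p, hK₁min⟩ := (T.patch e).exists_min_image (fun L => (μ L)⁻¹) ⟨L, hL⟩
  have hK₁ : K₁ ∈ T.minPatch μ e := mem_minPatch.mpr ⟨hK₁p, hK₁min⟩
  obtain ⟨M, hM, hMK₁⟩ : ∃ M ∈ T.patch e, M ≠ K₁ := by
    by_cases h : L = K₁
    · exact ⟨L', hL', fun h' => hne (h.trans h'.symm)⟩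
    · exact ⟨L, hL, h⟩
  rcases Relation.ReflTransGen.cases_tail (hq.sublevel_connected hΩ hn he hM hK₁) with h | h
  · exact absurd h.symm hMK₁
  · obtain ⟨N, -, hN, -, ⟨hne', F', hF', hFN, hFK₁⟩, -⟩ := h
    exact ⟨F', mem_minFaces.mpr
      ⟨mem_interiorFaces_of_subset hN hK₁p hne' hF' hFN hFK₁, K₁, hK₁, hFK₁⟩⟩

theorem recoveryDof_eq (hn : T.IsUnitNormal n) (hc : ∀ L ∈ T.tets, ∀ x, curl (u L) x = c L)
    {s : Finset E3 → ℝ} (hs : ∀ L, s L = ⟪(μ L)⁻¹ • c L, t e⟫) :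
    T.recoveryDof μ n t u e = ∑ F ∈ T.minFaces μ e, (∑ F' ∈ T.minFaces μ e, area F')⁻¹ *
      (area F * (T.gammaMinus μ n F * s (T.elemMinus n F) +
        (1 - T.gammaMinus μ n F) * s (T.elemPlus n F))) := by
  refine Finset.sum_congr rfl fun F hF => ?_
  obtain ⟨hm, hp⟩ := elem_mem_patch hn (mem_minFaces.mp hF).1
  rw [← setIntegral_body_const]
  congr 2
  funext x
  rw [sigmaFace, sigma, sigma, hc _ (mem_patch.mp hm).1, hc _ (mem_patch.mp hp).1, inner_add_left,
    real_inner_smul_left _ _ (T.gammaMinus μ n F),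
    real_inner_smul_left _ _ (1 - T.gammaMinus μ n F), hs, hs]

/-- The degree of freedom is a convex combination of face averages. The factor `2` counts one
comparison of the average with `K₁` and one of `K₁` with `K`. -/
theorem QuasiMonotone.sqrt_mul_abs_recoveryDof_sub_le (hq : T.QuasiMonotone μ)
    (hΩ : IsLipschitzDomain Ω) {κ : ℝ} (hκ : T.ShapeRegular κ) (hμ : ∀ K ∈ T.tets, 0 < μ K)
    (hn : T.IsUnitNormal n) (hc : ∀ L ∈ T.tets, ∀ x, curl (u L) x = c L) (he : e ∈ T.edges)
    (hi : (T.interiorFaces e).Nonempty) {K : Finset E3} (hK : K ∈ T.patch e)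
    {s : Finset E3 → ℝ} (hs : ∀ L, s L = ⟪(μ L)⁻¹ • c L, t e⟫) :
    √(μ K) * |T.recoveryDof μ n t u e - s K| ≤
      2 * ∑ F ∈ T.interiorFaces e, T.edgeJump μ n s F := by
  set S := ∑ F ∈ T.interiorFaces e, T.edgeJump μ n s F with hS
  set A := ∑ F' ∈ T.minFaces μ e, area F' with hA
  have hareapos : ∀ F ∈ T.minFaces μ e, 0 < area F := fun F hF =>
    area_pos hn hκ (mem_interiorFaces.mp (mem_minFaces.mp hF).1).1
  have hApos : 0 < A := Finset.sum_pos hareapos (hq.minFaces_nonempty hΩ hn he hi)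
  have hAsum : ∑ F ∈ T.minFaces μ e, A⁻¹ * area F = 1 := by
    rw [← Finset.mul_sum, inv_mul_cancel₀ hApos.ne']
  set σ : Finset E3 → ℝ := fun F => T.gammaMinus μ n F * s (T.elemMinus n F) +
        (1 - T.gammaMinus μ n F) * s (T.elemPlus n F) with hσ
  have hface : ∀ F ∈ T.minFaces μ e, √(μ K) * |σ F - s K| ≤ 2 * S := by
    intro F hF
    obtain ⟨hFi, K₁, hK₁, hFK₁⟩ := mem_minFaces.mp hF
    have h1 := sqrt_mul_abs_average_sub_le hμ hn hFi hK hK₁ hFK₁ s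
    have h2 := hq.sqrt_mul_abs_sub_le hΩ hμ hn he hK hK₁ s
    have h3 : T.edgeJump μ n s F ≤ S := Finset.single_le_sum
      (f := fun F => T.edgeJump μ n s F) (fun F _ => edgeJump_nonneg s F) hFi
    have h4 : |σ F - s K| ≤ |σ F - s K₁| + |s K - s K₁| := by
      rw [abs_sub_comm (s K)]
      exact abs_sub_le _ _ _
    have h5 := mul_le_mul_of_nonneg_left h4 (Real.sqrt_nonneg (μ K))
    rw [mul_add] at h5
    linarith
  have hdiff : T.recoveryDof μ n t u e - s K =
      ∑ F ∈ T.minFaces μ e, A⁻¹ * area F * (σ F - s K) := by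
    rw [recoveryDof_eq hn hc hs]
    simp only [mul_sub]
    rw [Finset.sum_sub_distrib, ← Finset.sum_mul, hAsum, one_mul]
    simp only [mul_assoc, hσ]
    rfl
  rw [hdiff]
  calc √(μ K) * |∑ F ∈ T.minFaces μ e, A⁻¹ * area F * (σ F - s K)|
      ≤ √(μ K) * ∑ F ∈ T.minFaces μ e, |A⁻¹ * area F * (σ F - s K)| :=
        mul_le_mul_of_nonneg_left (Finset.abs_sum_le_sum_abs _ _) (Real.sqrt_nonneg _)
    _ = ∑ F ∈ T.minFaces μ e, A⁻¹ * area F * (√(μ K) * |σ F - s K|) := by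
        rw [Finset.mul_sum]
        refine Finset.sum_congr rfl fun F hF => ?_
        rw [abs_mul, abs_of_pos (mul_pos (inv_pos.mpr hApos) (hareapos F hF))]
        ring
    _ ≤ ∑ F ∈ T.minFaces μ e, A⁻¹ * area F * (2 * S) :=
        Finset.sum_le_sum fun F hF => mul_le_mul_of_nonneg_left (hface F hF)
          (mul_pos (inv_pos.mpr hApos) (hareapos F hF)).le
    _ = 2 * S := by rw [← Finset.sum_mul, hAsum, one_mul]

end Edge

/-! ### The indicator -/

theorem volume_body_le {K : Finset E3} (hK : K ∈ T.tets) :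
    volume.real (body K) ≤ Real.pi * 4 / 3 * diam K ^ 3 := by
  obtain ⟨z, hz⟩ := Finset.card_pos.mp (by rw [(mem_tets.mp hK).2]; norm_num : 0 < K.card)
  have hsub : body K ⊆ Metric.closedBall z (diam K) := fun x hx =>
    Metric.mem_closedBall.mpr (dist_le_diam hx (mem_body hz))
  have h := measureReal_mono (μ := volume) hsub Metric.isBounded_closedBall.measure_lt_top.ne
  rw [measureReal_def, measureReal_def, EuclideanSpace.volume_closedBall_fin_three,
    ENNReal.toReal_mul, ENNReal.toReal_pow, ENNReal.toReal_ofReal (diam_nonneg K),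
    ENNReal.toReal_ofReal (by positivity)] at h
  rw [mul_comm]
  exact h

/-- The faces around an edge of `K` are comparable in size with `K`. -/
theorem volume_body_le_mul_area {n : Finset E3 → E3} (hn : T.IsUnitNormal n) {κ : ℝ}
    (hκ : T.ShapeRegular κ) (hκ1 : 1 ≤ κ) {K e F : Finset E3} (hK : K ∈ T.tets)
    (he : e ∈ edgesOf K) (hF : F ∈ T.interiorFaces e) :
    volume.real (body K) ≤ 17 * κ ^ 5 * (diam F * area F) := by
  obtain ⟨x, r, hr, hball, hdiam⟩ := hκ K hK
  obtain ⟨hFT, L, hL, -, -, -, hFL, -⟩ := mem_interiorFaces.mp hF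
  obtain ⟨hLT, heL⟩ := mem_patch.mp hL
  obtain ⟨x', r', hr', hball', hdiam'⟩ := hκ L hLT
  have heF := subset_of_mem_interiorFaces hF
  obtain ⟨heK, hec⟩ := Finset.mem_powersetCard.mp he
  obtain ⟨z, w, hzw, rfl⟩ := Finset.card_eq_two.mp hec
  have hz : z ∈ ({z, w} : Finset E3) := by simp
  have hw : w ∈ ({z, w} : Finset E3) := by simp
  have hedge := (isTetrahedron hK).two_mul_le_dist hr hball (heK hz) (heK hw) hzw
  have hdF : 2 * r ≤ diam F :=
    hedge.trans (dist_le_diam (mem_body (heF hw)) (mem_body (heF hz)))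
  -- The shared edge links the two elements: `2r ≤ |e| ≤ h_F ≤ h_L ≤ 2κr'`.
  have hdL : 2 * r ≤ κ * (2 * r') := (hdF.trans (diam_mono hFL)).trans hdiam'
  have hrr' : r ≤ κ * r' := by linarith
  have harea := pi_mul_sq_le_area hn hLT hFT hFL hr' hball'
  have hκ0 : 0 < κ := by linarith
  have h1 : r ^ 2 ≤ κ ^ 2 * area F := by
    have h2 : r ^ 2 ≤ (κ * r') ^ 2 := pow_le_pow_left₀ hr.le hrr' 2
    have h3 : 1 * r' ^ 2 ≤ Real.pi * r' ^ 2 :=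
      mul_le_mul_of_nonneg_right (by linarith [Real.pi_gt_three]) (sq_nonneg _)
    have h4 := mul_le_mul_of_nonneg_left (h3.trans harea) (sq_nonneg κ)
    linarith [mul_pow κ r' 2]
  have h2 : 2 * r ^ 3 ≤ κ ^ 2 * (diam F * area F) := by
    calc 2 * r ^ 3 = 2 * r * r ^ 2 := by ring
      _ ≤ diam F * (κ ^ 2 * area F) := mul_le_mul hdF h1 (sq_nonneg _) (diam_nonneg F)
      _ = κ ^ 2 * (diam F * area F) := by ring
  calc volume.real (body K) ≤ Real.pi * 4 / 3 * diam K ^ 3 := volume_body_le hK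
    _ ≤ Real.pi * 4 / 3 * (κ * (2 * r)) ^ 3 := by
        gcongr
        exact diam_nonneg K
    -- `3.15 · 4/3 · 8 = 33.6 ≤ 2 · 17` is the origin of the constant `17`.
    _ ≤ 3.15 * 4 / 3 * (κ * (2 * r)) ^ 3 := by
        gcongr
        exact Real.pi_lt_d2.le
    _ ≤ 17 * κ ^ 3 * (2 * r ^ 3) := by
        have : 0 ≤ κ ^ 3 * r ^ 3 := by positivity
        nlinarith
    _ ≤ 17 * κ ^ 3 * (κ ^ 2 * (diam F * area F)) := by gcongr
    _ = 17 * κ ^ 5 * (diam F * area F) := by ring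

/-- A pointwise bound is multiplied by `√|K|`, and `|K|` is traded for `h_F |F|`. The factor `4κ` is
`2` from the degrees of freedom times `2κ` from the basis functions. -/
theorem QuasiMonotone.etaPerp_le {μ : Finset E3 → ℝ} (hq : T.QuasiMonotone μ)
    (hΩ : IsLipschitzDomain Ω) {κ : ℝ} (hκ : T.ShapeRegular κ) (hκ1 : 1 ≤ κ)
    (hμ : ∀ K ∈ T.tets, 0 < μ K) {n t : Finset E3 → E3} (hn : T.IsUnitNormal n)
    (ht : T.IsUnitTangent t) {u : Finset E3 → E3 → E3} (hu : ∀ K ∈ T.tets, IsNedelecPoly (u K))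
    {K : Finset E3} (hK : K ∈ T.tets) (hi : ∀ e ∈ edgesOf K, (T.interiorFaces e).Nonempty) :
    T.etaPerp μ n t u K ≤ 4 * κ * √(17 * κ ^ 5) *
      ∑ e ∈ edgesOf K, ∑ F ∈ T.interiorFaces e, √(diam F) * T.jumpNorm μ n u F := by
  have hκ0 : 0 < κ := by linarith
  have hT := isTetrahedron hK
  obtain ⟨x₀, r, hr, hball, hdiam⟩ := hκ K hK
  choose! c hc using fun K hK => (hu K hK).exists_curl_eq
  set s : Finset E3 → Finset E3 → ℝ := fun e L => ⟪(μ L)⁻¹ • c L, t e⟫ with hs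
  set J : Finset E3 → ℝ := fun e => ∑ F ∈ T.interiorFaces e, T.edgeJump μ n (s e) F with hJ
  have hJ0 : ∀ e, 0 ≤ J e := fun e => Finset.sum_nonneg fun F _ => edgeJump_nonneg _ _
  have hpoint : ∀ x ∈ body K, ‖√(μ K) • T.recovered μ n t u K x - (√(μ K))⁻¹ • curl (u K) x‖ ≤
      4 * κ * ∑ e ∈ edgesOf K, J e := by
    intro x hx
    -- The constant field `μ_K⁻¹ curl u` is expanded in the basis, so the error involves only
    -- differences of degrees of freedom.
    have hrep := hT.sum_inner_tangent_smul_nedelecBasis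
      (fun e he => ht e (mem_edges_of_mem_edgesOf hK he)) ((μ K)⁻¹ • c K) x
    have h1 : (√(μ K))⁻¹ • curl (u K) x = √(μ K) • ((μ K)⁻¹ • c K) := by
      rw [hc K hK, smul_smul]
      congr 1
      have := Real.sqrt_pos.mpr (hμ K hK)
      have h2 := Real.sq_sqrt (hμ K hK).le
      rw [eq_comm, mul_inv_eq_iff_eq_mul₀ (hμ K hK).ne', inv_mul_eq_div, eq_div_iff this.ne', ← h2,
        sq]
      simp
    rw [h1, ← smul_sub, recovered]
    conv_lhs => rw [← hrep]
    rw [← Finset.sum_sub_distrib, Finset.smul_sum, Finset.mul_sum]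
    refine norm_sum_le_of_le _ fun e he => ?_
    have heT := mem_edges_of_mem_edgesOf hK he
    obtain ⟨heK, hec⟩ := Finset.mem_powersetCard.mp he
    have hdof := hq.sqrt_mul_abs_recoveryDof_sub_le hΩ hκ hμ hn hc heT (hi e he)
      (mem_patch.mpr ⟨hK, heK⟩) (t := t) (s := s e) (fun L => rfl)
    have hbasis : ‖nedelecBasis t K e x‖ ≤ 2 * κ := by
      obtain ⟨z, w, hzw, rfl⟩ := Finset.card_eq_two.mp hec
      have hz : z ∈ ({z, w} : Finset E3) := by simp
      have hw : w ∈ ({z, w} : Finset E3) := by simp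
      obtain ⟨ht1, ht2⟩ := ht _ heT
      exact hT.norm_nedelecBasis_le (heK hz) (heK hw) hzw ht1 (ht2 z hz w hw) hr hball hdiam hx
    rw [← sub_smul, smul_smul, norm_smul, norm_mul, Real.norm_eq_abs, Real.norm_eq_abs,
      abs_of_nonneg (Real.sqrt_nonneg _)]
    calc √(μ K) * |T.recoveryDof μ n t u e - s e K| * ‖nedelecBasis t K e x‖
        ≤ 2 * J e * (2 * κ) :=
          mul_le_mul hdof hbasis (norm_nonneg _) (mul_nonneg zero_le_two (hJ0 e))
      _ = 4 * κ * J e := by ring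
  set Q := 4 * κ * ∑ e ∈ edgesOf K, J e with hQ
  have hQ0 : 0 ≤ Q := mul_nonneg (by positivity) (Finset.sum_nonneg fun e _ => hJ0 e)
  have heta : T.etaPerp μ n t u K ≤ Q * √(volume.real (body K)) := by
    have h1 := norm_setIntegral_le_of_norm_le_const (μ := volume) (s := body K) (C := Q ^ 2)
      (f := fun x => ‖√(μ K) • T.recovered μ n t u K x - (√(μ K))⁻¹ • curl (u K) x‖ ^ 2)
      (isCompact_body K).measure_lt_top (fun x hx => by
        rw [Real.norm_eq_abs, abs_of_nonneg (sq_nonneg _)]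
        exact pow_le_pow_left₀ (norm_nonneg _) (hpoint x hx) 2)
    have h2 := Real.sqrt_le_sqrt ((le_abs_self _).trans h1)
    rwa [Real.sqrt_mul (sq_nonneg Q), Real.sqrt_sq hQ0] at h2
  refine heta.trans ?_
  rw [hQ, mul_right_comm, mul_assoc (4 * κ), mul_assoc (4 * κ)]
  refine mul_le_mul_of_nonneg_left ?_ (by positivity)
  rw [Finset.mul_sum, Finset.mul_sum]
  refine Finset.sum_le_sum fun e he => ?_
  rw [hJ, Finset.mul_sum, Finset.mul_sum]
  refine Finset.sum_le_sum fun F hF => ?_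
  have hvol := Real.sqrt_le_sqrt (volume_body_le_mul_area hn hκ hκ1 hK he hF)
  rw [Real.sqrt_mul (by positivity), Real.sqrt_mul (diam_nonneg F)] at hvol
  calc √(volume.real (body K)) * T.edgeJump μ n (s e) F
      ≤ √(17 * κ ^ 5) * (√(diam F) * √(area F)) * T.edgeJump μ n (s e) F :=
        mul_le_mul_of_nonneg_right hvol (edgeJump_nonneg _ _)
    _ = √(17 * κ ^ 5) * (√(diam F) * (√(area F) * T.edgeJump μ n (s e) F)) := by ring
    _ ≤ √(17 * κ ^ 5) * (√(diam F) * T.jumpNorm μ n u F) := by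
        gcongr
        exact sqrt_area_mul_edgeJump_le hn ht (mem_edges_of_mem_edgesOf hK he) hc hF

theorem ShapeRegular.mono {κ κ' : ℝ} (hκ : T.ShapeRegular κ) (h : κ ≤ κ') : T.ShapeRegular κ' :=
  fun K hK => by
    obtain ⟨x, r, hr, hball, hdiam⟩ := hκ K hK
    exact ⟨x, r, hr, hball, hdiam.trans (mul_le_mul_of_nonneg_right h (by positivity))⟩

end Triangulation

end EdgeRecovery

open EdgeRecovery
theorem lemma4p13 (κ : ℝ) :
    ∃ c : ℝ, 0 < c ∧
      ∀ (Ω : Set E3), IsLipschitzDomain Ω →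
      ∀ (T : Triangulation Ω), T.ShapeRegular κ →
      ∀ (μ : Finset E3 → ℝ), (∀ K ∈ T.tets, 0 < μ K) → T.QuasiMonotone μ →
      ∀ (n t : Finset E3 → E3), T.IsUnitNormal n → T.IsUnitTangent t →
      ∀ (u : Finset E3 → E3 → E3), T.IsNedelec u →
      ∀ K ∈ T.tets, (∀ e ∈ edgesOf K, (T.interiorFaces e).Nonempty) →
        c * T.etaPerp μ n t u K ≤
          ∑ e ∈ edgesOf K, ∑ F ∈ T.interiorFaces e, √(diam F) * T.jumpNorm μ n u F := by
  -- `κ` is an arbitrary real; enlarging it to `max κ 1` only weakens shape regularity and keeps the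
  -- constant positive.
  have hκ1 : 1 ≤ max κ 1 := le_max_right _ _
  have hpos : 0 < 4 * max κ 1 * √(17 * max κ 1 ^ 5) := by positivity
  refine ⟨(4 * max κ 1 * √(17 * max κ 1 ^ 5))⁻¹, inv_pos.mpr hpos, ?_⟩
  intro Ω hΩ T hT μ hμ hq n t hn ht u hu K hK hi
  rw [inv_mul_le_iff₀ hpos]
  exact hq.etaPerp_le hΩ (hT.mono (le_max_left _ _)) hκ1 hμ hn ht hu.1 hK hi
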